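/- Let $\alpha,\beta\ge 0$ and $\delta>0$, and consider the damped Kepler problem in the plane $$\ddot u+\Delta(u,\dot u)\frac{\dot u}{|\dot u|}=-\frac{u}{|u|^3},\qquad \Delta(u,\dot u)=\delta\,\frac{|\dot u|^{\alpha+1}}{|u|^{\beta}},\qquad u\in\mathbb R^2\setminus\{0\},$$ (the friction term being $0$ where $\dot u=0$) on the phase space $\mathcal P=(\mathbb R^2\setminus\{0\})\times\mathbb R^2$ of initial conditions $(u_0,\dot u_0)=(u(0),\dot u(0))$. Let $[0,\omega)$, $\omega\in(0,\infty]$, denote the forward maximal interval of existence of the solution with a given initial condition. With the angular momentum $L(u,\dot u)=u\wedge\dot u$, let $$\mathcal E(u,\dot u)=\dot u\wedge L(u,\dot u)-\frac{u}{|u|}$$ be the eccentricity vector (a vector of the plane), write $\mathcal E(t)=\mathcal E(u(t),\dot u(t))$, and let $e(t)=|\mathcal E(t)|$ be the eccentricity. One says that there is circularization at $(u_0,\dot u_0)\in\mathcal P$ if $e(t)\to 0$ as $t\to\omega^-$ along the solution with this initial condition. Suppose that $\gamma:=\alpha+2\beta-3>0$. Then: 1. There is no circularization at any initial condition $(u_0,\dot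 u_0)\in\mathcal P$. 2. There exists a non-empty open set $\mathcal U\subset\mathcal P$ such that for each $(u_0,\dot u_0)\in\mathcal U$ there is a vector $\mathcal E_\omega\in\mathbb R^2$ with $|\mathcal E_\omega|=1$ such that $\mathcal E(t)\to\mathcal E_\omega$ as $t\to\omega^-$ along the solution with initial condition $(u_0,\dot u_0)$. -/

import Mathlib

open Set Filter Topology

noncomputable section

namespace DampedKepler

/-- The Euclidean plane. -/
abbrev Plane : Type := EuclideanSpace ℝ (Fin 2)

/-- The phase space `(ℝ² ∖ {0}) × ℝ²`, with points `(position, velocity)`. -/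
def phaseSpace : Set (Plane × Plane) := {z | z.1 ≠ 0}

/-- The angular momentum `u ∧ v`. For planar vectors it points along the normal of the plane;
this is its component along the unit normal. -/
def angularMomentum (u v : Plane) : ℝ := u 0 * v 1 - u 1 * v 0

/-- The eccentricity vector `v ∧ L - u / |u|` with `L = u ∧ v`. The cross product of the planar
vector `v` with `L` times the unit normal is the planar vector `(v₁ L, - v₀ L)`. -/
def eccentricityVector (u v : Plane) : Plane :=
  !₂[v 1 * angularMomentum u v, -(v 0 * angularMomentum u v)] - ‖u‖⁻¹ • u

/-- The eccentricity, the Euclidean norm of the eccentricity vector. -/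
def eccentricity (u v : Plane) : ℝ := ‖eccentricityVector u v‖

/-- The friction law `Δ(u, v) = δ |v| ^ (α + 1) / |u| ^ β`. -/
def friction (α β δ : ℝ) (u v : Plane) : ℝ := δ * ‖v‖ ^ (α + 1) / ‖u‖ ^ β

/-- The acceleration `- u / |u|³ - Δ(u, v) v / |v|`. At `v = 0` the friction term is `0`; for the law
`friction α β δ` with `0 ≤ α` this is its continuous extension, as the term equals
`δ |v| ^ α v / |u| ^ β`. -/
def acceleration (Δ : Plane → Plane → ℝ) (u v : Plane) : Plane :=
  -((‖u‖ ^ 3)⁻¹ • u) - Δ u v • (‖v‖⁻¹ • v)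

/-- The time interval `[0, ω)`, for an end time `ω` that may be `⊤`. -/
def timeInterval (ω : EReal) : Set ℝ := {t | 0 ≤ t ∧ (t : EReal) < ω}

/-- The filter of `t → ω⁻`: it is `𝓝[<] ω` for a real `ω`, and `atTop` for `ω = ⊤`. -/
def endFilter (ω : EReal) : Filter ℝ := comap ((↑) : ℝ → EReal) (𝓝[<] ω)

/-- The curve `u`, with velocity `w`, solves the damped Kepler problem on `[0, ω)`, `ω ∈ (0, ∞]`
(with one-sided derivatives at time `0`). -/
structure IsSolution (Δ : Plane → Plane → ℝ) (ω : EReal) (u w : ℝ → Plane) : Prop where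
  pos : 0 < ω
  mem : ∀ t ∈ timeInterval ω, (u t, w t) ∈ phaseSpace
  hasDeriv_position : ∀ t ∈ timeInterval ω, HasDerivWithinAt u (w t) (Ici 0) t
  hasDeriv_velocity : ∀ t ∈ timeInterval ω,
    HasDerivWithinAt w (acceleration Δ (u t) (w t)) (Ici 0) t

/-- The curve `u`, with velocity `w`, is the solution with initial condition `z`, and `[0, ω)` is its
forward maximal interval: no solution extends it beyond `ω`. -/
structure IsMaximalSolution (Δ : Plane → Plane → ℝ) (z : Plane × Plane) (ω : EReal)
    (u w : ℝ → Plane) : Prop extends IsSolution Δ ω u w where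
  init_position : u 0 = z.1
  init_velocity : w 0 = z.2
  maximal : ∀ (ω' : EReal) (u' w' : ℝ → Plane), IsSolution Δ ω' u' w' →
    EqOn u' u (timeInterval ω) → EqOn w' w (timeInterval ω) → ω' ≤ ω

/-- Circularization at `z`: along the maximal solution from `z` the eccentricity tends to `0`
as `t → ω⁻`. -/
def CircularizesAt (Δ : Plane → Plane → ℝ) (z : Plane × Plane) : Prop :=
  ∃ (ω : EReal) (u w : ℝ → Plane), IsMaximalSolution Δ z ω u w ∧
    Tendsto (fun t => eccentricity (u t) (w t)) (endFilter ω) (𝓝 0)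

end DampedKepler

end

open Set Filter Topology

namespace DampedKepler

/-! Write `r = |u|`, `n = u / r`, `D = δ |v| ^ α / r ^ β`. Gravity conserves both `L` and `E`, so
friction alone moves them: `(L²)' = -2 D L²` and `E' = -2 D (E + n)`, while `n` turns at speed `|L|
/ r²`.

No circularization. If `e ≤ 1/4` from some time on, then `r` is comparable to `L²` and `|v|` to `1 /
|L|`. Hence `L²` cannot stay away from `0` (`IsMaximalSolution.exists_angularMomentum_sq_lt`), and
`n` turns at speed at most a constant times `D (L²) ^ (γ/2)` (`rotation_le_of_eccentricity_le`). For
`γ > 0` this is minus the derivative of a multiple of `(L²) ^ (γ/2)`, so the total turning after a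
late time is small and `n` stays near a fixed `n₀`. Then `⟨n₀, E⟩` decreases at least as fast as
`(1/4) log L²`, which drops without bound: a contradiction.

Convergence to eccentricity one. Gravity and friction balance in radial fall at speed of order `r ^
κ`, `κ = (β - 2) / (α + 1)`, and `γ > 0` says exactly that `2 κ + 1 > 0`. Near the origin,
`trappingRegion` asks for inward speed above `k r ^ κ`, negative energy and `|L| < k r ^ m`, `m =
|κ| + 2`. It is positively invariant: drag makes `L² r ^ (-2m)` nonincreasing (`exists_drag_large`),
and at critical speed gravity beats all other terms (`IsTrapping.boundary_deriv_pos`). There `r →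
0`, the turning speed is at most `-r'`, so `n` converges, and `v ∧ L → 0`; thus `E` tends to minus
the limit of `n`.

Uniqueness of solutions is not needed: both arguments apply to any maximal solution. -/

lemma timeInterval_mono {ω : EReal} {s t : ℝ} (ht : t ∈ timeInterval ω) (hs : 0 ≤ s)
    (hst : s ≤ t) : s ∈ timeInterval ω :=
  ⟨hs, lt_of_le_of_lt (EReal.coe_le_coe_iff.2 hst) ht.2⟩

lemma zero_mem_timeInterval {ω : EReal} (hω : 0 < ω) : (0 : ℝ) ∈ timeInterval ω :=
  ⟨le_rfl, by simpa using hω⟩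

/-- Handles finite `ω` and `⊤` at once: a real number always fits between `max b 0` and `ω` in
`EReal`. -/
lemma hasBasis_endFilter {ω : EReal} (hω : 0 < ω) :
    (endFilter ω).HasBasis (fun t₀ : ℝ => t₀ ∈ timeInterval ω)
      (fun t₀ => {t | t ∈ timeInterval ω ∧ t₀ ≤ t}) := by
  have h := (nhdsLT_basis_of_exists_lt ⟨0, hω⟩).comap ((↑) : ℝ → EReal)
  refine h.to_hasBasis ?_ ?_
  · intro b hb
    obtain ⟨t₀, h1, h2⟩ := EReal.lt_iff_exists_real_btwn.1 (max_lt hb hω)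
    have h0 : (0 : EReal) < t₀ := lt_of_le_of_lt (le_max_right _ _) h1
    refine ⟨t₀, ⟨by exact_mod_cast h0.le, h2⟩, fun t ht => ⟨?_, ht.1.2⟩⟩
    exact lt_of_lt_of_le (lt_of_le_of_lt (le_max_left _ _) h1) (EReal.coe_le_coe_iff.2 ht.2)
  · intro t₀ ht₀
    refine ⟨t₀, ht₀.2, fun t ht => ?_⟩
    have h1 : t₀ < t := EReal.coe_lt_coe_iff.1 ht.1
    exact ⟨⟨ht₀.1.trans h1.le, ht.2⟩, h1.le⟩

lemma eventually_endFilter {ω : EReal} (hω : 0 < ω) {p : ℝ → Prop} :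
    (∀ᶠ t in endFilter ω, p t) ↔
      ∃ t₀ ∈ timeInterval ω, ∀ t ∈ timeInterval ω, t₀ ≤ t → p t := by
  rw [(hasBasis_endFilter hω).eventually_iff]
  simp

lemma endFilter_neBot {ω : EReal} (hω : 0 < ω) : (endFilter ω).NeBot :=
  (hasBasis_endFilter hω).neBot_iff.2 fun {t} ht => ⟨t, ht, le_rfl⟩

/-! ### Comparison and convergence on `[0, ω)` -/

section Monotone

variable {F : Type*} [NormedAddCommGroup F] {ω : EReal}

/-- A curve whose increments are bounded by those of a bounded antitone function converges. -/
lemma exists_tendsto_endFilter [CompleteSpace F] (hω : 0 < ω) {f : ℝ → F} {g : ℝ → ℝ} {B t₁ : ℝ}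
    (ht₁ : t₁ ∈ timeInterval ω)
    (hfg : ∀ s ∈ timeInterval ω, ∀ t ∈ timeInterval ω, t₁ ≤ s → s ≤ t → ‖f t - f s‖ ≤ g s - g t)
    (hB : ∀ t ∈ timeInterval ω, t₁ ≤ t → B ≤ g t) : ∃ l, Tendsto f (endFilter ω) (𝓝 l) := by
  have := endFilter_neBot hω
  set S := g '' {t | t ∈ timeInterval ω ∧ t₁ ≤ t} with hS
  have hne : S.Nonempty := ⟨_, t₁, ⟨ht₁, le_rfl⟩, rfl⟩
  have hbdd : BddBelow S := ⟨B, by rintro _ ⟨t, ht, rfl⟩; exact hB t ht.1 ht.2⟩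
  refine cauchy_map_iff_exists_tendsto.1 (Metric.cauchy_iff.2 ⟨inferInstance, fun ε hε => ?_⟩)
  -- Once `g` is within `ε / 2` of its infimum, too little decrease is left for `f` to move by `ε /
  -- 2`.
  obtain ⟨_, ⟨t₀, ht₀, rfl⟩, h1⟩ :=
    exists_lt_of_csInf_lt hne (lt_add_of_pos_right (sInf S) (half_pos hε))
  refine ⟨f '' {t | t ∈ timeInterval ω ∧ t₀ ≤ t},
    image_mem_map ((hasBasis_endFilter hω).mem_of_mem ht₀.1), ?_⟩
  have key : ∀ t ∈ timeInterval ω, t₀ ≤ t → ‖f t - f t₀‖ < ε / 2 := by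
    intro t ht h
    have h2 := hfg t₀ ht₀.1 t ht ht₀.2 h
    have h3 : sInf S ≤ g t := csInf_le hbdd ⟨t, ⟨ht, ht₀.2.trans h⟩, rfl⟩
    linarith
  rintro _ ⟨s, ⟨hs, hs0⟩, rfl⟩ _ ⟨t, ⟨ht, ht0⟩, rfl⟩
  have e : f s - f t = (f s - f t₀) - (f t - f t₀) := by abel
  rw [dist_eq_norm, e]
  linarith [norm_sub_le (f s - f t₀) (f t - f t₀), key s hs hs0, key t ht ht0]

variable [NormedSpace ℝ F]

/-- The decrease of `g` pays for the motion of `f`. Applied with `g` linear in time, a power of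
`L²`, or the radius. -/
lemma norm_sub_le_of_norm_deriv_le {f f' : ℝ → F} {g g' : ℝ → ℝ} {t₀ : ℝ}
    (hf : ∀ t ∈ timeInterval ω, HasDerivWithinAt f (f' t) (Ici 0) t)
    (hg : ∀ t ∈ timeInterval ω, t₀ ≤ t → HasDerivWithinAt g (g' t) (Ici 0) t)
    (h : ∀ t ∈ timeInterval ω, t₀ ≤ t → ‖f' t‖ ≤ -g' t) :
    ∀ s ∈ timeInterval ω, ∀ t ∈ timeInterval ω, t₀ ≤ s → s ≤ t →
      ‖f t - f s‖ ≤ g s - g t := by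
  intro s hs t ht h0 hst
  have hm : ∀ x ∈ Icc s t, x ∈ timeInterval ω := fun x hx =>
    timeInterval_mono ht (hs.1.trans hx.1) hx.2
  refine image_norm_le_of_norm_deriv_right_le_deriv_boundary' (a := s) (b := t)
    (f := fun x => f x - f s) (f' := f') (B := fun x => g s - g x) (B' := fun x => - g' x)
    ?_ ?_ (by simp) ?_ ?_ ?_ ⟨hst, le_rfl⟩
  · intro x hx
    exact (((hf x (hm x hx)).continuousWithinAt).mono fun y hy => hs.1.trans hy.1).sub
      continuousWithinAt_const
  · intro x hx
    exact ((hf x (hm x ⟨hx.1, hx.2.le⟩)).mono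
      (Ici_subset_Ici.2 (hs.1.trans hx.1))).sub_const (f s)
  · intro x hx
    exact continuousWithinAt_const.sub
      (((hg x (hm x hx) (h0.trans hx.1)).continuousWithinAt).mono fun y hy => hs.1.trans hy.1)
  · intro x hx
    exact ((hg x (hm x ⟨hx.1, hx.2.le⟩) (h0.trans hx.1)).mono
      (Ici_subset_Ici.2 (hs.1.trans hx.1))).const_sub (g s)
  · intro x hx
    exact h x (hm x ⟨hx.1, hx.2.le⟩) (h0.trans hx.1)

lemma le_of_deriv_nonpos {g g' : ℝ → ℝ} {t₀ : ℝ}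
    (hg : ∀ t ∈ timeInterval ω, t₀ ≤ t → HasDerivWithinAt g (g' t) (Ici 0) t)
    (h : ∀ t ∈ timeInterval ω, t₀ ≤ t → g' t ≤ 0) :
    ∀ s ∈ timeInterval ω, ∀ t ∈ timeInterval ω, t₀ ≤ s → s ≤ t → g t ≤ g s := by
  intro s hs t ht h0 hst
  have := norm_sub_le_of_norm_deriv_le (F := ℝ) (f := fun _ => 0) (f' := fun _ => 0)
    (fun t _ => hasDerivWithinAt_const _ _ _) hg (by intro t ht h1; simpa using h t ht h1)
    s hs t ht h0 hst
  simpa using this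

end Monotone

/-- A function that starts positive, and whose derivative is positive at each time where it vanishes
after having been nonnegative, stays positive. -/
lemma pos_of_deriv_pos_of_eq_zero {ω : EReal} {g g' : ℝ → ℝ}
    (hg : ∀ t ∈ timeInterval ω, HasDerivWithinAt g (g' t) (Ici 0) t) (h0 : 0 < g 0)
    (h : ∀ t ∈ timeInterval ω, (∀ s ∈ Icc 0 t, 0 ≤ g s) → g t = 0 → 0 < g' t) :
    ∀ t ∈ timeInterval ω, 0 < g t := by
  intro T hT
  by_contra hneg
  have hcont : ContinuousOn g (Icc 0 T) := fun t ht =>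
    ((hg t (timeInterval_mono hT ht.1 ht.2)).continuousWithinAt).mono fun y hy => hy.1
  have hS : IsCompact (Icc 0 T ∩ g ⁻¹' Iic 0) :=
    isCompact_Icc.of_isClosed_subset (hcont.preimage_isClosed_of_isClosed isClosed_Icc isClosed_Iic)
      inter_subset_left
  obtain ⟨t, ⟨⟨ht0, htT⟩, hgt⟩, hleast⟩ :=
    hS.exists_isLeast ⟨T, ⟨hT.1, le_rfl⟩, not_lt.1 hneg⟩
  have hgt : g t ≤ 0 := hgt
  have htpos : 0 < t := by
    rcases ht0.eq_or_lt with e | e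
    · rw [← e] at hgt; linarith
    · exact e
  have hbefore : ∀ s, 0 ≤ s → s < t → 0 < g s := by
    intro s hs hst
    by_contra hc
    exact absurd (hleast ⟨⟨hs, hst.le.trans htT⟩, not_lt.1 hc⟩) (not_le.2 hst)
  have hm := timeInterval_mono hT ht0 htT
  have hd : HasDerivAt g (g' t) t := (hg t hm).hasDerivAt (Ici_mem_nhds htpos)
  have hev : ∀ᶠ s in 𝓝[<] t, 0 < g s :=
    mem_of_superset (Ioo_mem_nhdsLT htpos) fun s hs => hbefore s hs.1.le hs.2
  have hge : 0 ≤ g t :=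
    ge_of_tendsto (hd.continuousAt.tendsto.mono_left nhdsWithin_le_nhds)
      (hev.mono fun s hs => hs.le)
  have hz : g t = 0 := le_antisymm hgt hge
  have hpos := h t hm (fun s hs => by
    rcases hs.2.eq_or_lt with e | e
    · rw [e, hz]
    · exact (hbefore s hs.1 e).le) hz
  -- At the first zero the slopes from the left are negative, so their limit cannot be positive.
  have hslope : Tendsto (slope g t) (𝓝[<] t) (𝓝 (g' t)) := (hasDerivAt_iff_tendsto_slope.1 hd).mono_left
    (nhdsWithin_mono t (fun s (hs : s < t) => hs.ne))
  have h1 := hslope.eventually (lt_mem_nhds hpos)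
  obtain ⟨s, hs1, hs2, hs3⟩ := (h1.and (hev.and self_mem_nhdsWithin)).exists
  have hs3 : s < t := hs3
  rw [slope_def_field, hz] at hs1
  have : (0 - g s) / (t - s) < 0 := div_neg_of_neg_of_pos (by linarith) (by linarith)
  have e : (g s - 0) / (s - t) = (0 - g s) / (t - s) := by
    rw [← neg_div_neg_eq]; ring
  rw [e] at hs1
  linarith

/-- One-sided continuations with matching values and derivatives glue to a differentiable curve. -/
lemma hasDerivAt_ite_of_tendsto {F : Type*} [NormedAddCommGroup F] [NormedSpace ℝ F]
    {f f' g : ℝ → F} {a b : ℝ} {l : F} (hab : a < b)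
    (hf : ∀ t ∈ Ioo a b, HasDerivAt f (f' t) t)
    (hlim : Tendsto f (𝓝[<] b) (𝓝 (g b))) (hlim' : Tendsto f' (𝓝[<] b) (𝓝 l))
    (hg : HasDerivAt g l b) :
    HasDerivAt (fun t => if t < b then f t else g t) l b := by
  set k := fun t => if t < b then f t else g t with hk
  have hd : ∀ t ∈ Ioo a b, HasDerivAt k (f' t) t := fun t ht =>
    (hf t ht).congr_of_eventuallyEq (by
      filter_upwards [Iio_mem_nhds ht.2] with s hs
      simp [hk, show s < b from hs])
  have hkb : k b = g b := by simp [hk]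
  have h1 : HasDerivWithinAt k l (Iic b) b := by
    refine hasDerivWithinAt_Iic_of_tendsto_deriv (s := Ioo a b)
      (fun t ht => (hd t ht).differentiableAt.differentiableWithinAt) ?_ (Ioo_mem_nhdsLT hab) ?_
    · rw [ContinuousWithinAt, hkb]
      refine (hlim.mono_left (nhdsWithin_mono _ fun t ht => ht.2)).congr' ?_
      filter_upwards [self_mem_nhdsWithin] with t ht
      simp [hk, ht.2]
    · refine hlim'.congr' ?_
      filter_upwards [Ioo_mem_nhdsLT hab] with t ht
      exact (hd t ht).deriv.symm
  have h2 : HasDerivWithinAt k l (Ici b) b :=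
    hg.hasDerivWithinAt.congr (fun t ht => by simp [hk, not_lt.2 (show b ≤ t from ht)]) hkb
  have := h1.union h2
  rwa [Iic_union_Ici, hasDerivWithinAt_univ] at this

/-! ### Regularity of the vector field and local existence -/

/-- The friction coefficient `δ |v| ^ α / |u| ^ β` in front of the velocity. -/
noncomputable def drag (α β δ : ℝ) (u v : Plane) : ℝ := δ * ‖v‖ ^ α / ‖u‖ ^ β

lemma drag_nonneg {α β δ : ℝ} (hδ : 0 < δ) (u v : Plane) : 0 ≤ drag α β δ u v := by
  unfold drag; positivity

lemma acceleration_friction (α β δ : ℝ) (u v : Plane) :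
    acceleration (friction α β δ) u v = -((‖u‖ ^ 3)⁻¹ • u) - drag α β δ u v • v := by
  unfold acceleration friction drag
  rcases eq_or_ne v 0 with rfl | hv
  · simp
  · have hv' : 0 < ‖v‖ := norm_pos_iff.2 hv
    rw [smul_smul, Real.rpow_add_one hv'.ne']
    congr 2
    field_simp

/-- The planar phase-space vector field of the damped Kepler problem. -/
noncomputable def phaseField (α β δ : ℝ) (z : Plane × Plane) : Plane × Plane :=
  (z.2, acceleration (friction α β δ) z.1 z.2)

/-- For `0 < α < 1` the power `x ^ α` is not Lipschitz at `0`, but its increment appears only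
multiplied by the smaller norm, where the increment of the differentiable `x ^ (α + 1)` dominates
it. -/
lemma norm_rpow_smul_sub_le {F : Type*} [NormedAddCommGroup F] [NormedSpace ℝ F] {α R : ℝ}
    (hα : 0 ≤ α) {a b : F} (ha : ‖a‖ ≤ R) (hb : ‖b‖ ≤ R) :
    ‖‖a‖ ^ α • a - ‖b‖ ^ α • b‖ ≤ (α + 2) * R ^ α * ‖a - b‖ := by
  wlog hab : ‖b‖ ≤ ‖a‖ generalizing a b
  · rw [norm_sub_rev, norm_sub_rev a b]
    exact this hb ha (le_of_not_ge hab)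
  have e : ‖a‖ ^ α • a - ‖b‖ ^ α • b = ‖a‖ ^ α • (a - b) + (‖a‖ ^ α - ‖b‖ ^ α) • b := by
    rw [smul_sub, sub_smul]; abel
  have hR : 0 ≤ R := (norm_nonneg a).trans ha
  have h1 : ‖a‖ ^ α ≤ R ^ α := Real.rpow_le_rpow (norm_nonneg _) ha hα
  have h2 : ‖b‖ ^ α ≤ ‖a‖ ^ α := Real.rpow_le_rpow (norm_nonneg _) hab hα
  have h3 : ‖a‖ ^ (α + 1) - ‖b‖ ^ (α + 1) ≤ (α + 1) * R ^ α * (‖a‖ - ‖b‖) := by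
    have hd : ∀ x ∈ Icc 0 R, HasDerivWithinAt (fun x : ℝ => x ^ (α + 1))
        ((α + 1) * x ^ α) (Icc 0 R) x := fun x _ => by
      simpa using (Real.hasDerivAt_rpow_const (x := x) (p := α + 1)
        (Or.inr (by linarith))).hasDerivWithinAt
    have hbound : ∀ x ∈ Icc 0 R, ‖(α + 1) * x ^ α‖ ≤ (α + 1) * R ^ α := fun x hx => by
      have : 0 ≤ x ^ α := Real.rpow_nonneg hx.1 _
      rw [Real.norm_of_nonneg (by positivity)]
      exact mul_le_mul_of_nonneg_left (Real.rpow_le_rpow hx.1 hx.2 hα) (by linarith)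
    have := (convex_Icc 0 R).norm_image_sub_le_of_norm_hasDerivWithin_le hd hbound
      ⟨norm_nonneg b, hb⟩ ⟨norm_nonneg a, ha⟩
    rw [Real.norm_eq_abs, Real.norm_eq_abs, abs_of_nonneg (sub_nonneg.2 hab)] at this
    exact (le_abs_self _).trans this
  have h4 : (‖a‖ ^ α - ‖b‖ ^ α) * ‖b‖ ≤ ‖a‖ ^ (α + 1) - ‖b‖ ^ (α + 1) := by
    rw [Real.rpow_add_one' (norm_nonneg _) (by linarith),
      Real.rpow_add_one' (norm_nonneg _) (by linarith)]
    nlinarith [Real.rpow_nonneg (norm_nonneg a) α]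
  have h5 : ‖a‖ - ‖b‖ ≤ ‖a - b‖ := norm_sub_norm_le a b
  have hRα : 0 ≤ R ^ α := Real.rpow_nonneg hR _
  have h6 : (α + 1) * R ^ α * (‖a‖ - ‖b‖) ≤ (α + 1) * R ^ α * ‖a - b‖ :=
    mul_le_mul_of_nonneg_left h5 (by positivity)
  have h7 : ‖a‖ ^ α * ‖a - b‖ ≤ R ^ α * ‖a - b‖ :=
    mul_le_mul_of_nonneg_right h1 (norm_nonneg _)
  rw [e]
  refine (norm_add_le _ _).trans ?_
  rw [norm_smul, norm_smul, Real.norm_of_nonneg (Real.rpow_nonneg (norm_nonneg a) α),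
    Real.norm_of_nonneg (sub_nonneg.2 h2)]
  linarith

/-- The product of locally Lipschitz functions is locally Lipschitz. -/
lemma exists_lipschitzOnWith_smul {X F : Type*} [PseudoMetricSpace X] [NormedAddCommGroup F]
    [NormedSpace ℝ F] {f : X → ℝ} {g : X → F} {x : X}
    (hf : ∃ K, ∃ s ∈ 𝓝 x, LipschitzOnWith K f s) (hg : ∃ K, ∃ s ∈ 𝓝 x, LipschitzOnWith K g s) :
    ∃ K, ∃ s ∈ 𝓝 x, LipschitzOnWith K (fun y => f y • g y) s := by
  obtain ⟨K, s, hs, hf⟩ := hf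
  obtain ⟨K', s', hs', hg⟩ := hg
  have hcf : ContinuousAt f x := hf.continuousOn.continuousAt hs
  have hcg : ContinuousAt g x := hg.continuousOn.continuousAt hs'
  have h1 : ∀ᶠ y in 𝓝 x, ‖f y‖ < ‖f x‖ + 1 := hcf.norm.eventually (gt_mem_nhds (by linarith))
  have h2 : ∀ᶠ y in 𝓝 x, ‖g y‖ < ‖g x‖ + 1 := hcg.norm.eventually (gt_mem_nhds (by linarith))
  refine ⟨Real.toNNReal ((‖f x‖ + 1) * K' + K * (‖g x‖ + 1)), _,
    inter_mem (inter_mem hs hs') (inter_mem h1 h2), LipschitzOnWith.of_dist_le_mul ?_⟩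
  rintro a ⟨⟨ha, ha'⟩, ha1, ha2⟩ b ⟨⟨hb, hb'⟩, hb1, hb2⟩
  rw [Real.coe_toNNReal _ (by positivity)]
  have e : f a • g a - f b • g b = f a • (g a - g b) + (f a - f b) • g b := by
    rw [smul_sub, sub_smul]; abel
  have k1 := hf.dist_le_mul a ha b hb
  have k2 := hg.dist_le_mul a ha' b hb'
  rw [dist_eq_norm] at k1 k2 ⊢
  rw [e]
  refine (norm_add_le _ _).trans ?_
  rw [norm_smul, norm_smul]
  have ha1 : ‖f a‖ < ‖f x‖ + 1 := ha1
  have hb2 : ‖g b‖ < ‖g x‖ + 1 := hb2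
  have m1 : ‖f a‖ * ‖g a - g b‖ ≤ (‖f x‖ + 1) * (K' * dist a b) :=
    mul_le_mul ha1.le k2 (norm_nonneg _) (by positivity)
  have m2 : ‖f a - f b‖ * ‖g b‖ ≤ (K * dist a b) * (‖g x‖ + 1) :=
    mul_le_mul k1 hb2.le (norm_nonneg _) (by positivity)
  linarith

lemma exists_lipschitzOnWith_phaseField {α : ℝ} (hα : 0 ≤ α) (β δ : ℝ) {z : Plane × Plane}
    (hz : z ∈ phaseSpace) :
    ∃ K, ∃ s ∈ 𝓝 z, LipschitzOnWith K (phaseField α β δ) s := by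
  have hz : z.1 ≠ 0 := hz
  have hn : ContDiffAt ℝ 1 (fun y : Plane × Plane => ‖y.1‖) z := contDiffAt_fst.norm ℝ hz
  have hz' : ‖z.1‖ ≠ 0 := norm_ne_zero_iff.2 hz
  have h1 : ∃ K, ∃ s ∈ 𝓝 z, LipschitzOnWith K
      (fun y : Plane × Plane => -((‖y.1‖ ^ 3)⁻¹ • y.1)) s := by
    refine ContDiffAt.exists_lipschitzOnWith (𝕂 := ℝ) ?_
    exact (((hn.pow 3).inv (pow_ne_zero 3 hz')).smul contDiffAt_fst).neg
  -- The drag term splits into a factor smooth away from the origin and `|v| ^ α v`, which need not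
  -- be smooth at `v = 0`.
  have h2 : ∃ K, ∃ s ∈ 𝓝 z, LipschitzOnWith K
      (fun y : Plane × Plane => δ / ‖y.1‖ ^ β) s := by
    refine ContDiffAt.exists_lipschitzOnWith (𝕂 := ℝ) ?_
    exact contDiffAt_const.div (hn.rpow_const_of_ne hz')
      (Real.rpow_pos_of_pos (norm_pos_iff.2 hz) _).ne'
  have h3 : ∃ K, ∃ s ∈ 𝓝 z, LipschitzOnWith K
      (fun y : Plane × Plane => ‖y.2‖ ^ α • y.2) s := by
    have hb : ∀ᶠ y : Plane × Plane in 𝓝 z, ‖y.2‖ < ‖z.2‖ + 1 :=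
      continuous_snd.norm.continuousAt.eventually (gt_mem_nhds (by linarith))
    refine ⟨Real.toNNReal ((α + 2) * (‖z.2‖ + 1) ^ α), _, hb, LipschitzOnWith.of_dist_le_mul ?_⟩
    intro a ha b hb
    rw [Real.coe_toNNReal _ (by positivity), dist_eq_norm]
    refine (norm_rpow_smul_sub_le hα (le_of_lt ha) (le_of_lt hb)).trans ?_
    refine mul_le_mul_of_nonneg_left ?_ (by positivity)
    rw [dist_eq_norm]
    exact norm_snd_le (a - b)
  obtain ⟨K₁, s₁, hs₁, hl₁⟩ := h1
  obtain ⟨K₂, s₂, hs₂, hl₂⟩ := exists_lipschitzOnWith_smul h2 h3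
  have h4 := (hl₁.mono (inter_subset_left (t := s₂))).sub (hl₂.mono inter_subset_right)
  have h5 := (LipschitzWith.prod_snd (α := Plane) (β := Plane)).lipschitzOnWith (s := s₁ ∩ s₂)
  have e : phaseField α β δ = fun y => (y.2,
      -((‖y.1‖ ^ 3)⁻¹ • y.1) - (δ / ‖y.1‖ ^ β) • ‖y.2‖ ^ α • y.2) := by
    funext y
    simp only [phaseField]
    rw [acceleration_friction, smul_smul, drag, mul_div_right_comm]
  exact ⟨_, s₁ ∩ s₂, inter_mem hs₁ hs₂, e ▸ h5.prodMk h4⟩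

lemma continuousAt_phaseField {α : ℝ} (hα : 0 ≤ α) (β δ : ℝ) {z : Plane × Plane}
    (hz : z ∈ phaseSpace) : ContinuousAt (phaseField α β δ) z := by
  obtain ⟨K, s, hs, h⟩ := exists_lipschitzOnWith_phaseField hα β δ hz
  exact h.continuousOn.continuousAt hs

lemma isOpen_phaseSpace : IsOpen phaseSpace := isOpen_ne.preimage continuous_fst

/-- Local existence of solutions through every point of the phase space. -/
lemma exists_local_solution {α : ℝ} (hα : 0 ≤ α) (β δ : ℝ) {z : Plane × Plane}
    (hz : z ∈ phaseSpace) (t₀ : ℝ) :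
    ∃ ε > 0, ∃ u w : ℝ → Plane, u t₀ = z.1 ∧ w t₀ = z.2 ∧ ∀ t ∈ Ioo (t₀ - ε) (t₀ + ε),
      u t ≠ 0 ∧ HasDerivAt u (w t) t ∧
        HasDerivAt w (acceleration (friction α β δ) (u t) (w t)) t := by
  obtain ⟨K, s, hs, hl⟩ := exists_lipschitzOnWith_phaseField hα β δ hz
  obtain ⟨a, ha, has⟩ := Metric.nhds_basis_closedBall.mem_iff.1 hs
  -- The `+ 1` keeps the speed bound positive, so that `a / L` is a positive time of existence.
  set L : NNReal := ‖phaseField α β δ z‖₊ + K * ⟨a, ha.le⟩ + 1 with hL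
  have hL0 : (0 : ℝ) < L := by rw [hL]; push_cast; positivity
  have hb : ∀ x ∈ Metric.closedBall z a, ‖phaseField α β δ x‖ ≤ L := by
    intro x hx
    have h1 := hl.dist_le_mul x (has hx) z (has (Metric.mem_closedBall_self ha.le))
    have h2 : (K : ℝ) * dist x z ≤ K * a :=
      mul_le_mul_of_nonneg_left (Metric.mem_closedBall.1 hx) K.2
    have h3 := norm_le_norm_add_norm_sub' (phaseField α β δ x) (phaseField α β δ z)
    rw [dist_eq_norm] at h1
    have h4 : (L : ℝ) = ‖phaseField α β δ z‖ + K * a + 1 := rfl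
    linarith
  have ht₀ : t₀ ∈ Icc (t₀ - a / L) (t₀ + a / L) := by
    constructor <;> linarith [div_pos ha hL0]
  have hpl : IsPicardLindelof (fun _ => phaseField α β δ) (⟨t₀, ht₀⟩ : Icc _ _) z
      ⟨a, ha.le⟩ 0 L K := by
    refine IsPicardLindelof.of_time_independent hb (hl.mono has) ?_
    simp only [add_sub_cancel_left, sub_sub_cancel, max_self, NNReal.coe_zero, sub_zero]
    change (L : ℝ) * (a / L) ≤ a
    rw [mul_div_cancel₀ _ hL0.ne']
  obtain ⟨f, hf0, hf⟩ := hpl.exists_eq_forall_mem_Icc_hasDerivWithinAt₀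
  have hf0 : f t₀ = z := hf0
  have hd : ∀ t ∈ Ioo (t₀ - a / L) (t₀ + a / L), HasDerivAt f (phaseField α β δ (f t)) t :=
    fun t ht => (hf t ⟨ht.1.le, ht.2.le⟩).hasDerivAt (Icc_mem_nhds ht.1 ht.2)
  have hpos := div_pos ha hL0
  have hc : ContinuousAt f t₀ := (hd t₀ ⟨by linarith, by linarith⟩).continuousAt
  have hmem : f ⁻¹' phaseSpace ∈ 𝓝 t₀ :=
    hc.preimage_mem_nhds (isOpen_phaseSpace.mem_nhds (by rw [hf0]; exact hz))
  obtain ⟨ε, hε, hball⟩ := Metric.mem_nhds_iff.1 hmem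
  rw [Real.ball_eq_Ioo] at hball
  refine ⟨min ε (a / L), lt_min hε hpos, fun t => (f t).1, fun t => (f t).2, by simp [hf0],
    by simp [hf0], fun t ht => ?_⟩
  have m1 := min_le_left ε (a / L)
  have m2 := min_le_right ε (a / L)
  have h := hd t ⟨by linarith [ht.1], by linarith [ht.2]⟩
  refine ⟨hball ⟨by linarith [ht.1], by linarith [ht.2]⟩, ?_, ?_⟩
  · exact h.fst
  · exact h.snd

/-! ### Continuation and maximal solutions -/

lemma nhdsLT_le_endFilter {T : ℝ} (hT : 0 < T) : 𝓝[<] T ≤ endFilter (T : EReal) := by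
  refine (hasBasis_endFilter (by exact_mod_cast hT)).ge_iff.2 fun t₀ ht₀ => ?_
  refine mem_of_superset (Ioo_mem_nhdsLT (EReal.coe_lt_coe_iff.1 ht₀.2)) fun t ht => ?_
  exact ⟨⟨ht₀.1.trans ht.1.le, EReal.coe_lt_coe_iff.2 ht.2⟩, ht.1.le⟩

lemma IsSolution.hasDerivAt_position {Δ : Plane → Plane → ℝ} {ω : EReal} {u w : ℝ → Plane}
    (h : IsSolution Δ ω u w) {t : ℝ} (ht : t ∈ timeInterval ω) (h0 : 0 < t) :
    HasDerivAt u (w t) t :=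
  (h.hasDeriv_position t ht).hasDerivAt (Ici_mem_nhds h0)

lemma IsSolution.hasDerivAt_velocity {Δ : Plane → Plane → ℝ} {ω : EReal} {u w : ℝ → Plane}
    (h : IsSolution Δ ω u w) {t : ℝ} (ht : t ∈ timeInterval ω) (h0 : 0 < t) :
    HasDerivAt w (acceleration Δ (u t) (w t)) t :=
  (h.hasDeriv_velocity t ht).hasDerivAt (Ici_mem_nhds h0)

/-- A solution with a finite end time that has a limit in the phase space can be extended. -/
lemma IsSolution.exists_extension {α : ℝ} (hα : 0 ≤ α) {β δ T : ℝ} {u w : ℝ → Plane}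
    (h : IsSolution (friction α β δ) (T : EReal) u w) {z : Plane × Plane} (hz : z ∈ phaseSpace)
    (hu : Tendsto u (endFilter (T : EReal)) (𝓝 z.1))
    (hw : Tendsto w (endFilter (T : EReal)) (𝓝 z.2)) :
    ∃ (ω' : EReal) (u' w' : ℝ → Plane), IsSolution (friction α β δ) ω' u' w' ∧
      EqOn u' u (timeInterval T) ∧ EqOn w' w (timeInterval T) ∧ (T : EReal) < ω' := by
  have hT : 0 < T := by exact_mod_cast h.pos
  have hu := hu.mono_left (nhdsLT_le_endFilter hT)
  have hw := hw.mono_left (nhdsLT_le_endFilter hT)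
  obtain ⟨ε, hε, U, W, hU0, hW0, hUW⟩ := exists_local_solution hα β δ hz T
  have hmem : ∀ t ∈ Ioo 0 T, t ∈ timeInterval T := fun t ht =>
    ⟨ht.1.le, EReal.coe_lt_coe_iff.2 ht.2⟩
  have hTm := hUW T ⟨by linarith, by linarith⟩
  have hdu : HasDerivAt (fun t => if t < T then u t else U t) (W T) T :=
    hasDerivAt_ite_of_tendsto hT (fun t ht => h.hasDerivAt_position (hmem t ht) ht.1)
      (by rwa [hU0]) (by rwa [hW0]) hTm.2.1
  have hdw : HasDerivAt (fun t => if t < T then w t else W t)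
      (acceleration (friction α β δ) (U T) (W T)) T := by
    refine hasDerivAt_ite_of_tendsto hT (fun t ht => h.hasDerivAt_velocity (hmem t ht) ht.1)
      (by rwa [hW0]) ?_ hTm.2.2
    rw [hU0, hW0]
    exact ((continuousAt_phaseField hα β δ hz).tendsto.comp (hu.prodMk_nhds hw)).snd_nhds
  refine ⟨((T + ε : ℝ) : EReal), fun t => if t < T then u t else U t,
    fun t => if t < T then w t else W t, ⟨?_, ?_, ?_, ?_⟩, ?_, ?_, ?_⟩
  · exact_mod_cast (by linarith : 0 < T + ε)
  · intro t ht
    have ht2 := EReal.coe_lt_coe_iff.1 ht.2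
    by_cases hlt : t < T
    · simpa [hlt] using h.mem t ⟨ht.1, EReal.coe_lt_coe_iff.2 hlt⟩
    · simp only [hlt, if_false]
      exact (hUW t ⟨by linarith [not_lt.1 hlt], ht2⟩).1
  · intro t ht
    have ht2 := EReal.coe_lt_coe_iff.1 ht.2
    rcases lt_trichotomy t T with hlt | rfl | hgt
    · simp only [hlt, if_true]
      refine (h.hasDeriv_position t ⟨ht.1, EReal.coe_lt_coe_iff.2 hlt⟩).congr_of_eventuallyEq
        ?_ (by simp [hlt])
      filter_upwards [mem_nhdsWithin_of_mem_nhds (Iio_mem_nhds hlt)] with s hs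
      simp [show s < T from hs]
    · simpa using hdu.hasDerivWithinAt
    · simp only [not_lt.2 hgt.le, if_false]
      refine ((hUW t ⟨by linarith, ht2⟩).2.1.congr_of_eventuallyEq ?_).hasDerivWithinAt
      filter_upwards [Ioi_mem_nhds hgt] with s hs
      simp [not_lt.2 (le_of_lt (show T < s from hs))]
  · intro t ht
    have ht2 := EReal.coe_lt_coe_iff.1 ht.2
    rcases lt_trichotomy t T with hlt | rfl | hgt
    · simp only [hlt, if_true]
      refine (h.hasDeriv_velocity t ⟨ht.1, EReal.coe_lt_coe_iff.2 hlt⟩).congr_of_eventuallyEq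
        ?_ (by simp [hlt])
      filter_upwards [mem_nhdsWithin_of_mem_nhds (Iio_mem_nhds hlt)] with s hs
      simp [show s < T from hs]
    · simpa using hdw.hasDerivWithinAt
    · simp only [not_lt.2 hgt.le, if_false]
      refine ((hUW t ⟨by linarith, ht2⟩).2.2.congr_of_eventuallyEq ?_).hasDerivWithinAt
      filter_upwards [Ioi_mem_nhds hgt] with s hs
      simp [not_lt.2 (le_of_lt (show T < s from hs))]
  · intro t ht
    simp [EReal.coe_lt_coe_iff.1 ht.2]
  · intro t ht
    simp [EReal.coe_lt_coe_iff.1 ht.2]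
  · exact EReal.coe_lt_coe_iff.2 (by linarith)

/-- A maximal solution with a finite end time eventually leaves each set of phase points with
position bounded away from the origin and bounded velocity. -/
lemma IsMaximalSolution.not_bounded {α β δ : ℝ} (hα : 0 ≤ α) (hβ : 0 ≤ β) (hδ : 0 < δ)
    {z : Plane × Plane} {ω : EReal} {u w : ℝ → Plane}
    (h : IsMaximalSolution (friction α β δ) z ω u w) (hω : ω ≠ ⊤) {t₁ c C : ℝ}
    (ht₁ : t₁ ∈ timeInterval ω) (hc : 0 < c)
    (hb : ∀ t ∈ timeInterval ω, t₁ ≤ t → c ≤ ‖u t‖ ∧ ‖w t‖ ≤ C) : False := by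
  lift ω to ℝ using ⟨hω, fun e => by simpa [e] using h.pos⟩
  have hC : 0 ≤ C := (norm_nonneg _).trans (hb t₁ ht₁ le_rfl).2
  -- A curve with bounded derivative has a limit at a finite end time; used for position and
  -- velocity.
  have hlim : ∀ {f f' : ℝ → Plane} {A : ℝ}, 0 ≤ A →
      (∀ t ∈ timeInterval (ω : EReal), HasDerivWithinAt f (f' t) (Ici 0) t) →
      (∀ t ∈ timeInterval (ω : EReal), t₁ ≤ t → ‖f' t‖ ≤ A) →
      ∃ l, Tendsto f (endFilter (ω : EReal)) (𝓝 l) := by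
    intro f f' A hA hf hA'
    refine exists_tendsto_endFilter (g := fun t => -A * t) (B := -A * ω) h.pos ht₁
      (norm_sub_le_of_norm_deriv_le hf (g' := fun _ => -A * 1)
        (fun t _ _ => ((hasDerivAt_id t).const_mul (-A)).hasDerivWithinAt) ?_) ?_
    · intro t ht h1
      simpa using hA' t ht h1
    · intro t ht _
      have := EReal.coe_lt_coe_iff.1 ht.2
      nlinarith
  obtain ⟨l, hl⟩ := hlim hC h.hasDeriv_position fun t ht h1 => (hb t ht h1).2
  obtain ⟨m, hm⟩ := hlim (A := (c ^ 2)⁻¹ + δ * C ^ α / c ^ β * C)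
    (by positivity) h.hasDeriv_velocity (by
      intro t ht h1
      obtain ⟨h2, h3⟩ := hb t ht h1
      have hr : 0 < ‖u t‖ := hc.trans_le h2
      rw [acceleration_friction]
      refine (norm_sub_le _ _).trans ?_
      rw [norm_neg, norm_smul, norm_smul, norm_inv, norm_pow, norm_norm,
        Real.norm_of_nonneg (drag_nonneg hδ _ _)]
      have e : (‖u t‖ ^ 3)⁻¹ * ‖u t‖ = (‖u t‖ ^ 2)⁻¹ := by field_simp
      have k1 : (‖u t‖ ^ 2)⁻¹ ≤ (c ^ 2)⁻¹ := by gcongr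
      have k2 : drag α β δ (u t) (w t) * ‖w t‖ ≤ δ * C ^ α / c ^ β * C := by
        unfold drag; gcongr
      rw [e]; linarith)
  have := endFilter_neBot h.pos
  have hlc : c ≤ ‖l‖ := ge_of_tendsto hl.norm
    ((eventually_endFilter h.pos).2 ⟨t₁, ht₁, fun t ht h1 => (hb t ht h1).1⟩)
  have hz : (l, m) ∈ phaseSpace := norm_pos_iff.1 (hc.trans_le hlc)
  obtain ⟨ω', u', w', h1, h2, h3, h4⟩ := h.toIsSolution.exists_extension hα hz hl hm
  exact absurd (h.maximal ω' u' w' h1 h2 h3) (not_le.2 h4)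

lemma timeInterval_subset {ω ω' : EReal} (h : ω ≤ ω') : timeInterval ω ⊆ timeInterval ω' :=
  fun _ ht => ⟨ht.1, ht.2.trans_le h⟩

/-- Being a solution is local in time. -/
lemma IsSolution.of_local {Δ : Plane → Plane → ℝ} {ω : EReal} {u w : ℝ → Plane} (hω : 0 < ω)
    (h : ∀ t ∈ timeInterval ω, ∃ (ω' : EReal) (u' w' : ℝ → Plane), IsSolution Δ ω' u' w' ∧
      t ∈ timeInterval ω' ∧ EqOn u u' (timeInterval ω') ∧ EqOn w w' (timeInterval ω')) :
    IsSolution Δ ω u w := by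
  have key : ∀ {f f' : ℝ → Plane} {ω' : EReal} {t : ℝ} {d : Plane}, t ∈ timeInterval ω' →
      EqOn f f' (timeInterval ω') → HasDerivWithinAt f' d (Ici 0) t →
      HasDerivWithinAt f d (Ici 0) t := by
    intro f f' ω' t d ht hff hd
    refine hd.congr_of_eventuallyEq ?_ (hff ht)
    obtain ⟨s, hs1, hs2⟩ := EReal.lt_iff_exists_real_btwn.1 ht.2
    filter_upwards [mem_nhdsWithin_of_mem_nhds (Iio_mem_nhds (EReal.coe_lt_coe_iff.1 hs1)),
      self_mem_nhdsWithin] with x hx hx0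
    exact hff ⟨hx0, (EReal.coe_lt_coe_iff.2 hx).trans hs2⟩
  refine ⟨hω, fun t ht => ?_, fun t ht => ?_, fun t ht => ?_⟩ <;>
    obtain ⟨ω', u', w', hs, ht', hu, hw⟩ := h t ht
  · rw [hu ht', hw ht']; exact hs.mem t ht'
  · rw [hw ht']; exact key ht' hu (hs.hasDeriv_position t ht')
  · rw [hu ht', hw ht']; exact key ht' hw (hs.hasDeriv_velocity t ht')

/-- Existence of maximal solutions. -/
lemma exists_isMaximalSolution {α : ℝ} (hα : 0 ≤ α) (β δ : ℝ) {z : Plane × Plane}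
    (hz : z ∈ phaseSpace) :
    ∃ (ω : EReal) (u w : ℝ → Plane), IsMaximalSolution (friction α β δ) z ω u w := by
  let S := {p : EReal × (ℝ → Plane) × (ℝ → Plane) //
    IsSolution (friction α β δ) p.1 p.2.1 p.2.2 ∧ p.2.1 0 = z.1 ∧ p.2.2 0 = z.2}
  -- Zorn's lemma for the extension order; members of a chain agree on common times, so they glue.
  let R : S → S → Prop := fun p q => p.1.1 ≤ q.1.1 ∧
    EqOn q.1.2.1 p.1.2.1 (timeInterval p.1.1) ∧ EqOn q.1.2.2 p.1.2.2 (timeInterval p.1.1)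
  have hne : Nonempty S := by
    obtain ⟨ε, hε, u, w, hu, hw, h⟩ := exists_local_solution hα β δ hz 0
    have hm : ∀ t ∈ timeInterval (ε : EReal), t ∈ Ioo (0 - ε) (0 + ε) := fun t ht =>
      ⟨by linarith [ht.1], by linarith [EReal.coe_lt_coe_iff.1 ht.2]⟩
    exact ⟨⟨((ε : EReal), u, w), ⟨EReal.coe_pos.2 hε, fun t ht => (h t (hm t ht)).1,
      fun t ht => (h t (hm t ht)).2.1.hasDerivWithinAt,
      fun t ht => (h t (hm t ht)).2.2.hasDerivWithinAt⟩, hu, hw⟩⟩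
  have htrans : ∀ {a b c : S}, R a b → R b c → R a c := fun {a b c} h1 h2 =>
    ⟨h1.1.trans h2.1, fun t ht => (h2.2.1 (timeInterval_subset h1.1 ht)).trans (h1.2.1 ht),
      fun t ht => (h2.2.2 (timeInterval_subset h1.1 ht)).trans (h1.2.2 ht)⟩
  have hchain : ∀ c, IsChain R c → c.Nonempty → ∃ ub, ∀ a ∈ c, R a ub := by
    intro c hc hcne
    classical
    have hagree : ∀ p ∈ c, ∀ q ∈ c, ∀ t, t ∈ timeInterval p.1.1 → t ∈ timeInterval q.1.1 →
        p.1.2.1 t = q.1.2.1 t ∧ p.1.2.2 t = q.1.2.2 t := by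
      intro p hp q hq t h1 h2
      rcases eq_or_ne p q with rfl | hpq
      · exact ⟨rfl, rfl⟩
      · rcases hc hp hq hpq with h | h
        · exact ⟨(h.2.1 h1).symm, (h.2.2 h1).symm⟩
        · exact ⟨h.2.1 h2, h.2.2 h2⟩
    obtain ⟨p₀, hp₀⟩ := hcne
    let Ω : EReal := sSup ((fun p : S => p.1.1) '' c)
    have hle : ∀ p ∈ c, p.1.1 ≤ Ω := fun p hp => le_sSup ⟨p, hp, rfl⟩
    have hex : ∀ t ∈ timeInterval Ω, ∃ p ∈ c, t ∈ timeInterval p.1.1 := by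
      intro t ht
      obtain ⟨_, ⟨p, hp, rfl⟩, h⟩ := lt_sSup_iff.1 ht.2
      exact ⟨p, hp, ht.1, h⟩
    let pick : ℝ → S := fun t => if h : ∃ p ∈ c, t ∈ timeInterval p.1.1 then h.choose else p₀
    have hpick : ∀ p ∈ c, ∀ t ∈ timeInterval p.1.1,
        (pick t).1.2.1 t = p.1.2.1 t ∧ (pick t).1.2.2 t = p.1.2.2 t := by
      intro p hp t ht
      have h : ∃ p ∈ c, t ∈ timeInterval p.1.1 := ⟨p, hp, ht⟩
      have e : pick t = h.choose := dif_pos h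
      rw [e]
      exact hagree _ h.choose_spec.1 p hp t h.choose_spec.2 ht
    have h0 := hpick p₀ hp₀ 0 (zero_mem_timeInterval p₀.2.1.pos)
    refine ⟨⟨(Ω, fun t => (pick t).1.2.1 t, fun t => (pick t).1.2.2 t), ?_, ?_, ?_⟩, ?_⟩
    · refine IsSolution.of_local (p₀.2.1.pos.trans_le (hle p₀ hp₀)) fun t ht => ?_
      obtain ⟨p, hp, htp⟩ := hex t ht
      exact ⟨p.1.1, p.1.2.1, p.1.2.2, p.2.1, htp, fun s hs => (hpick p hp s hs).1,
        fun s hs => (hpick p hp s hs).2⟩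
    · exact h0.1.trans p₀.2.2.1
    · exact h0.2.trans p₀.2.2.2
    · intro p hp
      exact ⟨hle p hp, fun t ht => (hpick p hp t ht).1, fun t ht => (hpick p hp t ht).2⟩
  obtain ⟨⟨⟨ω, u, w⟩, hs, hu, hw⟩, hm⟩ := exists_maximal_of_nonempty_chains_bounded hchain htrans
  refine ⟨ω, u, w, hs, hu, hw, fun ω' u' w' h' hu' hw' => ?_⟩
  by_contra hlt
  have h0 := zero_mem_timeInterval hs.pos
  exact hlt (hm ⟨(ω', u', w'), h', (hu' h0).trans hu, (hw' h0).trans hw⟩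
    ⟨(not_le.1 hlt).le, hu', hw'⟩).1

/-! ### Planar identities and evolution equations -/

lemma plane_inner_eq (u v : Plane) : inner ℝ u v = u 0 * v 0 + u 1 * v 1 := by
  simp [PiLp.inner_apply, Fin.sum_univ_two, mul_comm]

lemma plane_norm_sq (u : Plane) : ‖u‖ ^ 2 = u 0 ^ 2 + u 1 ^ 2 := by
  simp [EuclideanSpace.real_norm_sq_eq, Fin.sum_univ_two]

/-- The unit vector in the direction of the position. -/
noncomputable def direction (u : Plane) : Plane := ‖u‖⁻¹ • u

lemma norm_direction {u : Plane} (hu : u ≠ 0) : ‖direction u‖ = 1 := by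
  rw [direction, norm_smul, norm_inv, norm_norm, inv_mul_cancel₀ (norm_ne_zero_iff.2 hu)]

/-- The momentum part `v ∧ L` of the eccentricity vector. -/
noncomputable def momentumCross (u v : Plane) : Plane :=
  !₂[v 1 * angularMomentum u v, -(v 0 * angularMomentum u v)]

lemma eccentricityVector_eq (u v : Plane) :
    eccentricityVector u v = momentumCross u v - direction u := rfl

lemma eccentricityVector_add_direction (u v : Plane) :
    eccentricityVector u v + direction u = momentumCross u v := by
  rw [eccentricityVector_eq, sub_add_cancel]

lemma norm_momentumCross (u v : Plane) : ‖momentumCross u v‖ = ‖v‖ * |angularMomentum u v| := by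
  rw [← sq_eq_sq₀ (norm_nonneg _) (by positivity), mul_pow, plane_norm_sq, plane_norm_sq, sq_abs]
  simp [momentumCross]
  ring

/-- The polar equation of the osculating conic, from `⟨v ∧ L, u⟩ = L²`. -/
lemma inner_eccentricityVector_direction {u : Plane} (hu : u ≠ 0) (v : Plane) :
    inner ℝ (eccentricityVector u v) (direction u) = angularMomentum u v ^ 2 / ‖u‖ - 1 := by
  have h : inner ℝ (direction u) (direction u) = (1 : ℝ) := by
    rw [real_inner_self_eq_norm_sq, norm_direction hu, one_pow]
  rw [eccentricityVector_eq, inner_sub_left, h, direction, inner_smul_right, plane_inner_eq]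
  simp [momentumCross, angularMomentum]
  ring

lemma norm_sq_mul_norm_sq (u v : Plane) :
    ‖u‖ ^ 2 * ‖v‖ ^ 2 = inner ℝ u v ^ 2 + angularMomentum u v ^ 2 := by
  rw [plane_norm_sq, plane_norm_sq, plane_inner_eq, angularMomentum]; ring

lemma hasDerivWithinAt_coord {f : ℝ → Plane} {f' : Plane} {s : Set ℝ} {t : ℝ}
    (h : HasDerivWithinAt f f' s t) (i : Fin 2) :
    HasDerivWithinAt (fun t => f t i) (f' i) s t :=
  (EuclideanSpace.proj (𝕜 := ℝ) i).hasFDerivAt.comp_hasDerivWithinAt t h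

lemma hasDerivWithinAt_of_coord {f : ℝ → Plane} {f' : Plane} {s : Set ℝ} {t : ℝ}
    (h : ∀ i, HasDerivWithinAt (fun t => f t i) (f' i) s t) : HasDerivWithinAt f f' s t := by
  rw [hasDerivWithinAt_iff_hasFDerivWithinAt, hasFDerivWithinAt_euclidean]
  intro i
  refine (h i).hasFDerivWithinAt.congr_fderiv ?_
  ext
  simp

namespace IsSolution

variable {α β δ : ℝ} {ω : EReal} {u w : ℝ → Plane}

lemma ne_zero (h : IsSolution (friction α β δ) ω u w) {t : ℝ} (ht : t ∈ timeInterval ω) :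
    u t ≠ 0 := h.mem t ht

lemma norm_pos (h : IsSolution (friction α β δ) ω u w) {t : ℝ} (ht : t ∈ timeInterval ω) :
    0 < ‖u t‖ := norm_pos_iff.2 (h.ne_zero ht)

lemma hasDeriv_velocity' (h : IsSolution (friction α β δ) ω u w) {t : ℝ}
    (ht : t ∈ timeInterval ω) :
    HasDerivWithinAt w (-((‖u t‖ ^ 3)⁻¹ • u t) - drag α β δ (u t) (w t) • w t) (Ici 0) t := by
  rw [← acceleration_friction]; exact h.hasDeriv_velocity t ht

lemma hasDeriv_norm (h : IsSolution (friction α β δ) ω u w) {t : ℝ} (ht : t ∈ timeInterval ω) :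
    HasDerivWithinAt (fun t => ‖u t‖) (inner ℝ (u t) (w t) / ‖u t‖) (Ici 0) t := by
  have h1 := (h.hasDeriv_position t ht).norm_sq.sqrt (pow_ne_zero 2 (h.norm_pos ht).ne')
  simp only [Real.sqrt_sq (norm_nonneg _)] at h1
  convert h1 using 1
  ring

/-- Gravity is central and exerts no torque. -/
lemma hasDeriv_angularMomentum (h : IsSolution (friction α β δ) ω u w) {t : ℝ}
    (ht : t ∈ timeInterval ω) :
    HasDerivWithinAt (fun t => angularMomentum (u t) (w t))
      (-(drag α β δ (u t) (w t) * angularMomentum (u t) (w t))) (Ici 0) t := by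
  have hu := fun i => hasDerivWithinAt_coord (h.hasDeriv_position t ht) i
  have hw := fun i => hasDerivWithinAt_coord (h.hasDeriv_velocity' ht) i
  refine (((hu 0).mul (hw 1)).sub ((hu 1).mul (hw 0))).congr_deriv ?_
  simp [angularMomentum]
  ring

lemma hasDeriv_angularMomentum_sq (h : IsSolution (friction α β δ) ω u w) {t : ℝ}
    (ht : t ∈ timeInterval ω) :
    HasDerivWithinAt (fun t => angularMomentum (u t) (w t) ^ 2)
      (-(2 * drag α β δ (u t) (w t) * angularMomentum (u t) (w t) ^ 2)) (Ici 0) t := by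
  refine ((h.hasDeriv_angularMomentum ht).pow 2).congr_deriv ?_
  push_cast; ring

/-- The derivative of the direction, `L / |u|³` times the position turned by a right angle. -/
lemma hasDeriv_direction (h : IsSolution (friction α β δ) ω u w) {t : ℝ}
    (ht : t ∈ timeInterval ω) :
    HasDerivWithinAt (fun t => direction (u t))
      ((angularMomentum (u t) (w t) / ‖u t‖ ^ 3) • !₂[-(u t 1), u t 0]) (Ici 0) t := by
  have hr := (h.norm_pos ht).ne'
  refine (((h.hasDeriv_norm ht).inv hr).smul (h.hasDeriv_position t ht)).congr_deriv ?_
  have hn := plane_norm_sq (u t)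
  ext i
  fin_cases i <;> simp [plane_inner_eq, angularMomentum]
  all_goals field_simp
  · linear_combination (w t 0) * hn
  · linear_combination (w t 1) * hn

lemma norm_deriv_direction (h : IsSolution (friction α β δ) ω u w) {t : ℝ}
    (ht : t ∈ timeInterval ω) :
    ‖(angularMomentum (u t) (w t) / ‖u t‖ ^ 3) • (!₂[-(u t 1), u t 0] : Plane)‖ =
      |angularMomentum (u t) (w t)| / ‖u t‖ ^ 2 := by
  have hr := h.norm_pos ht
  have e : ‖(!₂[-(u t 1), u t 0] : Plane)‖ = ‖u t‖ := by
    rw [← sq_eq_sq₀ (norm_nonneg _) (norm_nonneg _), plane_norm_sq, plane_norm_sq]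
    simp [add_comm]
  rw [norm_smul, e, norm_div, norm_pow, norm_norm, Real.norm_eq_abs]
  field_simp

/-- Gravity changes `v ∧ L` exactly as `u / |u|` rotates, so these terms cancel; friction damps `v`
and `L` at rate `D` each, whence the factor `2`. -/
lemma hasDeriv_eccentricityVector (h : IsSolution (friction α β δ) ω u w) {t : ℝ}
    (ht : t ∈ timeInterval ω) :
    HasDerivWithinAt (fun t => eccentricityVector (u t) (w t))
      (-(2 * drag α β δ (u t) (w t)) • momentumCross (u t) (w t)) (Ici 0) t := by
  have hw := fun i => hasDerivWithinAt_coord (h.hasDeriv_velocity' ht) i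
  have hL := h.hasDeriv_angularMomentum ht
  have hm : HasDerivWithinAt (fun t => momentumCross (u t) (w t))
      (-(2 * drag α β δ (u t) (w t)) • momentumCross (u t) (w t) +
      (angularMomentum (u t) (w t) / ‖u t‖ ^ 3) • !₂[-(u t 1), u t 0]) (Ici 0) t := by
    refine hasDerivWithinAt_of_coord fun i => ?_
    fin_cases i
    · refine ((hw 1).mul hL).congr_deriv ?_
      simp [momentumCross]
      ring
    · refine ((hw 0).mul hL).neg.congr_deriv ?_
      simp [momentumCross]
      ring
  exact (hm.sub (h.hasDeriv_direction ht)).congr_deriv (by abel)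

lemma hasDeriv_energy (h : IsSolution (friction α β δ) ω u w) {t : ℝ}
    (ht : t ∈ timeInterval ω) :
    HasDerivWithinAt (fun t => ‖w t‖ ^ 2 / 2 - ‖u t‖⁻¹)
      (-(drag α β δ (u t) (w t) * ‖w t‖ ^ 2)) (Ici 0) t := by
  have hr := (h.norm_pos ht).ne'
  refine (((h.hasDeriv_velocity' ht).norm_sq.div_const 2).sub
    ((h.hasDeriv_norm ht).inv hr)).congr_deriv ?_
  rw [inner_sub_right, inner_neg_right, inner_smul_right, inner_smul_right,
    real_inner_self_eq_norm_sq, real_inner_comm]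
  field_simp
  ring

/-- The inward radial speed `-(d/dt)|u|` satisfies `ρ' = |u|⁻² - L² / |u|³ - D ρ`. -/
lemma hasDeriv_inward_speed (h : IsSolution (friction α β δ) ω u w) {t : ℝ}
    (ht : t ∈ timeInterval ω) :
    HasDerivWithinAt (fun t => -(inner ℝ (u t) (w t) / ‖u t‖))
      ((‖u t‖ ^ 2)⁻¹ - angularMomentum (u t) (w t) ^ 2 / ‖u t‖ ^ 3
        - drag α β δ (u t) (w t) * (-(inner ℝ (u t) (w t) / ‖u t‖))) (Ici 0) t := by
  have hr := (h.norm_pos ht).ne'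
  have hi : HasDerivWithinAt (fun t => inner ℝ (u t) (w t)) _ (Ici 0) t :=
    (h.hasDeriv_position t ht).inner ℝ (h.hasDeriv_velocity' ht)
  refine ((hi.div (h.hasDeriv_norm ht) hr).neg).congr_deriv ?_
  have e := norm_sq_mul_norm_sq (u t) (w t)
  rw [inner_sub_right, inner_neg_right, inner_smul_right, inner_smul_right,
    real_inner_self_eq_norm_sq, real_inner_self_eq_norm_sq]
  field_simp
  linear_combination (-1 : ℝ) * e

end IsSolution

/-! ### Small eccentricity is not sustainable -/

/-- Bounds for the phase points of small eccentricity. -/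
lemma bounds_of_eccentricity_le {u v : Plane} (hu : u ≠ 0)
    (he : ‖eccentricityVector u v‖ ≤ 1 / 4) :
    3 / 4 * ‖u‖ ≤ angularMomentum u v ^ 2 ∧ angularMomentum u v ^ 2 ≤ 5 / 4 * ‖u‖ ∧
      3 / 4 ≤ ‖v‖ * |angularMomentum u v| ∧ ‖v‖ * |angularMomentum u v| ≤ 5 / 4 := by
  have hr : 0 < ‖u‖ := norm_pos_iff.2 hu
  have h1 := abs_real_inner_le_norm (eccentricityVector u v) (direction u)
  rw [inner_eccentricityVector_direction hu, norm_direction hu, mul_one] at h1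
  obtain ⟨h2, h3⟩ := abs_le.1 (h1.trans he)
  have h4 : 3 / 4 ≤ angularMomentum u v ^ 2 / ‖u‖ := by linarith
  have h5 : angularMomentum u v ^ 2 / ‖u‖ ≤ 5 / 4 := by linarith
  have h6 := norm_add_le (eccentricityVector u v) (direction u)
  have h7 := norm_sub_norm_le (direction u) (-eccentricityVector u v)
  rw [eccentricityVector_add_direction, norm_momentumCross, norm_direction hu] at h6
  rw [sub_neg_eq_add, add_comm, eccentricityVector_add_direction, norm_momentumCross,
    norm_direction hu, norm_neg] at h7
  exact ⟨(le_div_iff₀ hr).1 h4, (div_le_iff₀ hr).1 h5, by linarith, by linarith⟩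

lemma IsSolution.angularMomentum_sq_le {α β δ : ℝ} (hδ : 0 < δ) {ω : EReal} {u w : ℝ → Plane}
    (h : IsSolution (friction α β δ) ω u w) {s t : ℝ} (hs : s ∈ timeInterval ω)
    (ht : t ∈ timeInterval ω) (hst : s ≤ t) :
    angularMomentum (u t) (w t) ^ 2 ≤ angularMomentum (u s) (w s) ^ 2 := by
  refine le_of_deriv_nonpos (t₀ := 0) (fun t ht _ => h.hasDeriv_angularMomentum_sq ht)
    (fun t _ _ => ?_) s hs t ht hs.1 hst
  have := drag_nonneg (α := α) (β := β) hδ (u t) (w t)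
  rw [neg_nonpos]; positivity

/-- While the eccentricity stays small, the angular momentum becomes arbitrarily small. -/
lemma IsMaximalSolution.exists_angularMomentum_sq_lt {α β δ : ℝ} (hα : 0 ≤ α) (hβ : 0 ≤ β)
    (hδ : 0 < δ) {z : Plane × Plane} {ω : EReal} {u w : ℝ → Plane}
    (h : IsMaximalSolution (friction α β δ) z ω u w) {t₁ : ℝ} (ht₁ : t₁ ∈ timeInterval ω)
    (he : ∀ t ∈ timeInterval ω, t₁ ≤ t → ‖eccentricityVector (u t) (w t)‖ ≤ 1 / 4)
    {ℓ : ℝ} (hℓ : 0 < ℓ) :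
    ∃ t ∈ timeInterval ω, t₁ ≤ t ∧ angularMomentum (u t) (w t) ^ 2 < ℓ := by
  by_contra! hcon
  set M := angularMomentum (u t₁) (w t₁) ^ 2 with hM
  have hM0 : 0 < M := hℓ.trans_le (hcon t₁ ht₁ le_rfl)
  -- The least drag compatible with `|v| ≥ 3 / (4 √M)` and `|u| ≤ 4 M / 3`.
  set d := δ * (3 / 4 / √M) ^ α / (4 / 3 * M) ^ β with hd
  have hd0 : 0 < d := by positivity
  have hb : ∀ t ∈ timeInterval ω, t₁ ≤ t →
      (4 / 5 * ℓ ≤ ‖u t‖ ∧ ‖w t‖ ≤ 5 / 4 / √ℓ) ∧ d ≤ drag α β δ (u t) (w t) := by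
    intro t ht h1
    obtain ⟨b1, b2, b3, b4⟩ := bounds_of_eccentricity_le (h.ne_zero ht) (he t ht h1)
    have hr := h.norm_pos ht
    have hL := hcon t ht h1
    have hL' : angularMomentum (u t) (w t) ^ 2 ≤ M := h.angularMomentum_sq_le hδ ht₁ ht h1
    have l1 : √ℓ ≤ |angularMomentum (u t) (w t)| := by
      rw [← Real.sqrt_sq_eq_abs]; exact Real.sqrt_le_sqrt hL
    have l2 : |angularMomentum (u t) (w t)| ≤ √M := by
      rw [← Real.sqrt_sq_eq_abs]; exact Real.sqrt_le_sqrt hL'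
    have hsℓ : 0 < √ℓ := Real.sqrt_pos.2 hℓ
    have hsM : 0 < √M := Real.sqrt_pos.2 hM0
    have hv1 : ‖w t‖ ≤ 5 / 4 / √ℓ := by
      rw [le_div_iff₀ hsℓ]
      exact (mul_le_mul_of_nonneg_left l1 (norm_nonneg _)).trans b4
    have hv2 : 3 / 4 / √M ≤ ‖w t‖ := by
      rw [div_le_iff₀ hsM]
      exact b3.trans (mul_le_mul_of_nonneg_left l2 (norm_nonneg _))
    refine ⟨⟨by linarith, hv1⟩, ?_⟩
    rw [hd, drag]
    have hr2 : ‖u t‖ ≤ 4 / 3 * M := by linarith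
    gcongr
  -- `L²` loses at least `2 d ℓ` per unit time, so `ω` is finite; the bounds in `hb` then contradict
  -- maximality.
  have hT : ∀ t ∈ timeInterval ω, t₁ ≤ t → 2 * d * ℓ * (t - t₁) ≤ M := by
    intro t ht h1
    have h2 := le_of_deriv_nonpos (t₀ := t₁)
      (g := fun t => angularMomentum (u t) (w t) ^ 2 + 2 * d * ℓ * t)
      (g' := fun t => -(2 * drag α β δ (u t) (w t) * angularMomentum (u t) (w t) ^ 2) +
        2 * d * ℓ * 1)
      (fun t ht _ => (h.hasDeriv_angularMomentum_sq ht).add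
        ((hasDerivAt_id t).const_mul (2 * d * ℓ)).hasDerivWithinAt)
      (fun t ht h1 => by
        have := mul_le_mul (hb t ht h1).2 (hcon t ht h1) hℓ.le (drag_nonneg hδ _ _)
        linarith) t₁ ht₁ t ht le_rfl h1
    linarith [sq_nonneg (angularMomentum (u t) (w t))]
  refine h.not_bounded hα hβ hδ ?_ ht₁ (by positivity) fun t ht h1 => (hb t ht h1).1
  rintro rfl
  have hq : 0 < M / (2 * d * ℓ) := by positivity
  have := hT (t₁ + (M / (2 * d * ℓ) + 1)) ⟨by linarith [ht₁.1], EReal.coe_lt_top _⟩ (by linarith)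
  have e : 2 * d * ℓ * (t₁ + (M / (2 * d * ℓ) + 1) - t₁) = M + 2 * d * ℓ := by
    field_simp; ring
  rw [e] at this
  have : 0 < 2 * d * ℓ := by positivity
  linarith

/-- For small eccentricity the rotation of the position is slow compared with the drag. -/
lemma rotation_le_of_eccentricity_le {α β δ : ℝ} (hα : 0 ≤ α) (hβ : 0 ≤ β) (hδ : 0 < δ)
    {u v : Plane} (hu : u ≠ 0) (he : ‖eccentricityVector u v‖ ≤ 1 / 4) :
    |angularMomentum u v| / ‖u‖ ^ 2 ≤ 25 / 16 / (δ * (3 / 4) ^ (α + β)) *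
      (drag α β δ u v * (angularMomentum u v ^ 2) ^ ((α + 2 * β - 3) / 2)) := by
  obtain ⟨b1, b2, b3, b4⟩ := bounds_of_eccentricity_le hu he
  have hr : 0 < ‖u‖ := norm_pos_iff.2 hu
  set l := |angularMomentum u v| with hl
  have hsq : angularMomentum u v ^ 2 = l ^ 2 := (sq_abs _).symm
  rw [hsq] at b1 b2 ⊢
  have hl0 : 0 < l := by
    rcases (abs_nonneg (angularMomentum u v)).eq_or_lt with e | e
    · rw [hl, ← e] at b3; norm_num at b3
    · exact e
  -- The origin of `γ`: drag is at least of order `l ^ (-α - 2 β)`, rotation at most of order `l ^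
  -- (-3)`.
  have e1 : (l ^ 2) ^ ((α + 2 * β - 3) / 2) = l ^ α * (l ^ 2) ^ β * (l ^ 3)⁻¹ := by
    rw [← Real.rpow_natCast l 2, ← Real.rpow_mul hl0.le, ← Real.rpow_mul hl0.le,
      ← Real.rpow_natCast l 3, ← Real.rpow_neg hl0.le, ← Real.rpow_add hl0, ← Real.rpow_add hl0]
    congr 1
    push_cast; ring
  have hD : δ * (3 / 4) ^ (α + β) * (l ^ α * (l ^ 2) ^ β)⁻¹ ≤ drag α β δ u v := by
    have e2 : δ * (3 / 4) ^ (α + β) * (l ^ α * (l ^ 2) ^ β)⁻¹ =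
        δ * (3 / 4 / l) ^ α / (4 / 3 * l ^ 2) ^ β := by
      rw [Real.div_rpow (by norm_num) hl0.le, Real.mul_rpow (by norm_num) (by positivity),
        Real.rpow_add (by norm_num), show (4 / 3 : ℝ) = (3 / 4)⁻¹ by norm_num,
        Real.inv_rpow (by norm_num)]
      field_simp
    rw [e2, drag]
    have hv : 3 / 4 / l ≤ ‖v‖ := (div_le_iff₀ hl0).2 b3
    have hr2 : ‖u‖ ≤ 4 / 3 * l ^ 2 := by linarith
    gcongr
  have h1 : l / ‖u‖ ^ 2 ≤ 25 / 16 * (l ^ 3)⁻¹ := by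
    have hr3 : 4 / 5 * l ^ 2 ≤ ‖u‖ := by linarith
    calc l / ‖u‖ ^ 2 ≤ l / (4 / 5 * l ^ 2) ^ 2 := by gcongr
      _ = 25 / 16 * (l ^ 3)⁻¹ := by field_simp; norm_num
  refine h1.trans ?_
  rw [e1]
  have hP : 0 < l ^ α * (l ^ 2) ^ β := by positivity
  calc 25 / 16 * (l ^ 3)⁻¹ = 25 / 16 / (δ * (3 / 4) ^ (α + β)) *
        (δ * (3 / 4) ^ (α + β) * (l ^ α * (l ^ 2) ^ β)⁻¹ *
          (l ^ α * (l ^ 2) ^ β * (l ^ 3)⁻¹)) := by field_simp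
    _ ≤ _ := by gcongr

/-- For `α + 2 β > 3` there is no circularization. -/
theorem not_circularizesAt {α β δ : ℝ} (hα : 0 ≤ α) (hβ : 0 ≤ β) (hδ : 0 < δ)
    (hγ : 0 < α + 2 * β - 3) (z : Plane × Plane) : ¬ CircularizesAt (friction α β δ) z := by
  rintro ⟨ω, u, w, h, hlim⟩
  obtain ⟨t₁, ht₁, he⟩ := (eventually_endFilter h.pos).1
    (hlim.eventually (ge_mem_nhds (by norm_num : (0 : ℝ) < 1 / 4)))
  have he : ∀ t ∈ timeInterval ω, t₁ ≤ t → ‖eccentricityVector (u t) (w t)‖ ≤ 1 / 4 := he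
  set γ := α + 2 * β - 3 with hγd
  set A := 25 / 16 / (δ * (3 / 4) ^ (α + β)) with hA
  have hA0 : 0 < A := by positivity
  have hLpos : ∀ t ∈ timeInterval ω, t₁ ≤ t → 0 < angularMomentum (u t) (w t) ^ 2 := by
    intro t ht h1
    have := (bounds_of_eccentricity_le (h.ne_zero ht) (he t ht h1)).1
    linarith [h.norm_pos ht]
  set K := A / γ with hK
  have hK0 : 0 < K := by positivity
  obtain ⟨t₀, ht₀, h10, hsmall⟩ := h.exists_angularMomentum_sq_lt hα hβ hδ ht₁ he
    -- Solves `K ℓ ^ (γ / 2) = 1 / 2`, the allowed total turning.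
    (ℓ := (1 / (2 * K)) ^ (2 / γ)) (by positivity)
  have hK2 : K * (angularMomentum (u t₀) (w t₀) ^ 2) ^ (γ / 2) ≤ 1 / 2 := by
    have : (angularMomentum (u t₀) (w t₀) ^ 2) ^ (γ / 2) ≤ 1 / (2 * K) := by
      calc (angularMomentum (u t₀) (w t₀) ^ 2) ^ (γ / 2)
          ≤ ((1 / (2 * K)) ^ (2 / γ)) ^ (γ / 2) := by gcongr
        _ = 1 / (2 * K) := by
          rw [← Real.rpow_mul (by positivity)]
          rw [show 2 / γ * (γ / 2) = 1 by field_simp, Real.rpow_one]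
    calc _ ≤ K * (1 / (2 * K)) := by gcongr
      _ = 1 / 2 := by field_simp
  have hrot : ∀ t ∈ timeInterval ω, t₀ ≤ t → ‖direction (u t) - direction (u t₀)‖ ≤ 1 / 2 := by
    intro t ht h0
    have := norm_sub_le_of_norm_deriv_le (t₀ := t₀) (fun t ht => h.hasDeriv_direction ht)
      (g := fun t => K * (angularMomentum (u t) (w t) ^ 2) ^ (γ / 2))
      (fun t ht h1 => ((h.hasDeriv_angularMomentum_sq ht).rpow_const
        (Or.inl (hLpos t ht (h10.trans h1)).ne')).const_mul K) ?_ t₀ ht₀ t ht le_rfl h0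
    · have h2 : 0 ≤ K * (angularMomentum (u t) (w t) ^ 2) ^ (γ / 2) := by positivity
      linarith
    · intro t ht h1
      rw [h.norm_deriv_direction ht]
      refine (rotation_le_of_eccentricity_le hα hβ hδ (h.ne_zero ht)
        (he t ht (h10.trans h1))).trans (le_of_eq ?_)
      have hq := hLpos t ht (h10.trans h1)
      rw [← hA, ← hγd, Real.rpow_sub_one hq.ne', hK]
      have hq' : angularMomentum (u t) (w t) ≠ 0 := fun e => by simp [e] at hq
      field_simp
  set n := direction (u t₀) with hn
  have hn1 : ‖n‖ = 1 := norm_direction (h.ne_zero ht₀)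
  have hinner : ∀ t ∈ timeInterval ω, t₀ ≤ t →
      |inner ℝ n (eccentricityVector (u t) (w t))| ≤ 1 / 4 := by
    intro t ht h0
    have := abs_real_inner_le_norm n (eccentricityVector (u t) (w t))
    rw [hn1, one_mul] at this
    exact this.trans (he t ht (h10.trans h0))
  -- Since `⟨n, E + direction u⟩ ≥ 1 / 4`, the inner product falls at rate at least `D / 2`, the
  -- rate at which `(1 / 4) log L²` falls.
  have hmono := le_of_deriv_nonpos (ω := ω) (t₀ := t₀)
    (g := fun t => inner ℝ n (eccentricityVector (u t) (w t)) -
      1 / 4 * Real.log (angularMomentum (u t) (w t) ^ 2))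
    (fun t ht h1 => ((hasDerivWithinAt_const t (Ici 0) n).inner ℝ
      (h.hasDeriv_eccentricityVector ht)).sub
      (((h.hasDeriv_angularMomentum_sq ht).log
        (hLpos t ht (h10.trans h1)).ne').const_mul (1 / 4)))
    (fun t ht h1 => by
      have hq := (hLpos t ht (h10.trans h1)).ne'
      have h2 : inner ℝ n (direction (u t)) = 1 - ‖direction (u t) - n‖ ^ 2 / 2 := by
        have := norm_sub_sq_real (direction (u t)) n
        rw [norm_direction (h.ne_zero ht), hn1, real_inner_comm] at this
        linarith
      have h3 := hrot t ht h1
      have h4 : ‖direction (u t) - n‖ ^ 2 ≤ (1 / 2) ^ 2 := by gcongr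
      have h5 : 1 / 4 ≤ inner ℝ n (momentumCross (u t) (w t)) := by
        rw [← eccentricityVector_add_direction, inner_add_right]
        have := (abs_le.1 (hinner t ht h1)).1
        linarith
      have hD := drag_nonneg (α := α) (β := β) hδ (u t) (w t)
      rw [inner_zero_left, add_zero, inner_smul_right, neg_div, mul_div_cancel_right₀ _ hq]
      nlinarith)
  obtain ⟨t, ht, h0, hlt⟩ := h.exists_angularMomentum_sq_lt hα hβ hδ ht₀
    (fun t ht h1 => he t ht (h10.trans h1))
    -- A logarithmic drop of `3` forces a drop of `3 / 4` in the inner product, which ranges over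
    -- `[-1/4, 1/4]`.
    (ℓ := Real.exp (Real.log (angularMomentum (u t₀) (w t₀) ^ 2) - 3)) (Real.exp_pos _)
  have h1 := hmono t₀ ht₀ t ht le_rfl h0
  have h2 := (Real.log_lt_iff_lt_exp (hLpos t ht (h10.trans h0))).2 hlt
  have h3 := (abs_le.1 (hinner t ht h0)).1
  have h4 := (abs_le.1 (hinner t₀ ht₀ le_rfl)).2
  linarith

/-! ### The trapping region and its constants -/

/-- The exponent `κ` of the terminal speed `|u| ^ κ` at which gravity balances friction. -/
noncomputable def terminalExponent (α β : ℝ) : ℝ := (β - 2) / (α + 1)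

/-- The power of `|u|` which dominates the angular momentum of a strongly damped fall. -/
noncomputable def decayExponent (α β : ℝ) : ℝ := |terminalExponent α β| + 2

/-- Phase points of small radius, negative energy, small angular momentum, and inward radial speed
above a multiple of the terminal speed. -/
def trappingRegion (α β k r₀ : ℝ) : Set (Plane × Plane) :=
  {z | z.1 ≠ 0 ∧ ‖z.1‖ < r₀ ∧ ‖z.2‖ ^ 2 / 2 - ‖z.1‖⁻¹ < 0 ∧
    angularMomentum z.1 z.2 ^ 2 * ‖z.1‖ ^ (-(2 * decayExponent α β)) < k ^ 2 ∧
    0 < -(inner ℝ z.1 z.2 / ‖z.1‖) - k * ‖z.1‖ ^ terminalExponent α β}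

/-- The constants for which the region is positively invariant. -/
structure IsTrapping (α β δ k r₀ : ℝ) : Prop where
  k_pos : 0 < k
  k_le : k ≤ 1 / 2
  drag_small : δ * 2 ^ α * k ^ (α + 1) ≤ 1 / 8
  exponent_small : |terminalExponent α β| * k ^ 2 ≤ 1 / 8
  r_pos : 0 < r₀
  r_le : r₀ ≤ 1
  drag_large : ∀ r v ρ : ℝ, 0 < r → r ≤ r₀ → k * r ^ terminalExponent α β ≤ ρ → ρ ≤ v →
    v ^ 2 ≤ 2 / r → decayExponent α β * (ρ / r) ≤ δ * v ^ α / r ^ β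

lemma exists_mul_rpow_le {m p c : ℝ} (hm : 0 < m) (hp : 0 < p) (hc : 0 < c) :
    ∃ r₀, 0 < r₀ ∧ r₀ ≤ 1 ∧ ∀ r, 0 < r → r ≤ r₀ → m * r ^ p ≤ c := by
  refine ⟨min 1 ((c / m) ^ p⁻¹), lt_min one_pos (by positivity), min_le_left _ _,
    fun r hr h => ?_⟩
  have h1 : r ^ p ≤ c / m := by
    calc r ^ p ≤ ((c / m) ^ p⁻¹) ^ p := by
          gcongr; exact h.trans (min_le_right _ _)
      _ = c / m := Real.rpow_inv_rpow (by positivity) hp.ne'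
  rw [le_div_iff₀ hm] at h1
  linarith

lemma two_mul_terminalExponent_add_one_pos {α β : ℝ} (hα : 0 ≤ α) (hγ : 0 < α + 2 * β - 3) :
    0 < 2 * terminalExponent α β + 1 := by
  have h : 2 * terminalExponent α β + 1 = (α + 2 * β - 3) / (α + 1) := by
    rw [terminalExponent]; field_simp; ring
  rw [h]; positivity

lemma decayExponent_pos (α β : ℝ) : 0 < decayExponent α β := by
  unfold decayExponent; positivity

/-- Close to the origin the drag dominates the logarithmic rate of change of the radius. -/
lemma exists_drag_large {α β δ k : ℝ} (hα : 0 ≤ α) (hδ : 0 < δ) (hγ : 0 < α + 2 * β - 3)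
    (hk : 0 < k) :
    ∃ r₀, 0 < r₀ ∧ r₀ ≤ 1 ∧ ∀ r v ρ : ℝ, 0 < r → r ≤ r₀ → k * r ^ terminalExponent α β ≤ ρ →
      ρ ≤ v → v ^ 2 ≤ 2 / r → decayExponent α β * (ρ / r) ≤ δ * v ^ α / r ^ β := by
  have hm := decayExponent_pos α β
  -- A lower bound for `v ^ (α - 1)` is needed: from the critical speed if `α ≥ 1`, from the energy
  -- bound `v² ≤ 2 / r` if `α < 1`. Either way a positive power of `r` proportional to `γ` is left
  -- over.
  rcases le_or_gt 1 α with h1 | h1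
  · obtain ⟨r₀, h0, hle, h⟩ := exists_mul_rpow_le (p := (α + 2 * β - 3) / (α + 1))
      (c := δ * k ^ (α - 1)) hm (by positivity) (by positivity)
    refine ⟨r₀, h0, hle, fun r v ρ hr hr0 hρ hv _ => ?_⟩
    have hρ0 : 0 < ρ := lt_of_lt_of_le (by positivity) hρ
    have hv0 : 0 < v := hρ0.trans_le hv
    have h2 : v ^ α = v ^ (α - 1) * v := by rw [Real.rpow_sub_one hv0.ne']; field_simp
    have h3 : k ^ (α - 1) * r ^ (terminalExponent α β * (α - 1)) ≤ v ^ (α - 1) := by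
      rw [Real.rpow_mul hr.le, ← Real.mul_rpow hk.le (by positivity)]
      exact Real.rpow_le_rpow (by positivity) (hρ.trans hv) (by linarith)
    have h4 : r ^ ((α + 2 * β - 3) / (α + 1)) * r ^ (terminalExponent α β * (α - 1)) =
        r ^ β / r := by
      rw [← Real.rpow_add hr, ← Real.rpow_sub_one hr.ne', terminalExponent]
      congr 1
      field_simp; ring
    rw [le_div_iff₀ (by positivity), h2]
    calc decayExponent α β * (ρ / r) * r ^ β
        = decayExponent α β * r ^ ((α + 2 * β - 3) / (α + 1)) *
          r ^ (terminalExponent α β * (α - 1)) * ρ := by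
          rw [mul_assoc (decayExponent α β) (r ^ ((α + 2 * β - 3) / (α + 1))), h4]; field_simp
      _ ≤ δ * k ^ (α - 1) * r ^ (terminalExponent α β * (α - 1)) * v := by
          exact mul_le_mul (mul_le_mul_of_nonneg_right (h r hr hr0) (by positivity)) hv hρ0.le
            (by positivity)
      _ = δ * (k ^ (α - 1) * r ^ (terminalExponent α β * (α - 1)) * v) := by ring
      _ ≤ δ * (v ^ (α - 1) * v) := by gcongr
  · obtain ⟨r₀, h0, hle, h⟩ := exists_mul_rpow_le (p := (α + 2 * β - 3) / 2)
      (c := δ * 2 ^ ((α - 1) / 2)) hm (by positivity) (by positivity)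
    refine ⟨r₀, h0, hle, fun r v ρ hr hr0 hρ hv hvr => ?_⟩
    have hρ0 : 0 < ρ := lt_of_lt_of_le (by positivity) hρ
    have hv0 : 0 < v := hρ0.trans_le hv
    have h2 : v ^ α = v ^ (α - 1) * v := by rw [Real.rpow_sub_one hv0.ne']; field_simp
    have h3 : 2 ^ ((α - 1) / 2) * r ^ ((1 - α) / 2) ≤ v ^ (α - 1) := by
      have e1 : (v ^ 2) ^ ((α - 1) / 2) = v ^ (α - 1) := by
        rw [← Real.rpow_natCast, ← Real.rpow_mul hv0.le]
        congr 1
        push_cast; ring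
      have e2 : (2 / r) ^ ((α - 1) / 2) = 2 ^ ((α - 1) / 2) * r ^ ((1 - α) / 2) := by
        rw [Real.div_rpow (by norm_num) hr.le, div_eq_mul_inv, ← Real.rpow_neg hr.le]
        congr 2
        ring
      rw [← e1, ← e2]
      exact Real.rpow_le_rpow_of_nonpos (by positivity) hvr (by linarith)
    have h4 : r ^ ((α + 2 * β - 3) / 2) * r ^ ((1 - α) / 2) = r ^ β / r := by
      rw [← Real.rpow_add hr, ← Real.rpow_sub_one hr.ne']
      congr 1
      ring
    rw [le_div_iff₀ (by positivity), h2]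
    calc decayExponent α β * (ρ / r) * r ^ β
        = decayExponent α β * r ^ ((α + 2 * β - 3) / 2) * r ^ ((1 - α) / 2) * ρ := by
          rw [mul_assoc (decayExponent α β) (r ^ ((α + 2 * β - 3) / 2)), h4]; field_simp
      _ ≤ δ * 2 ^ ((α - 1) / 2) * r ^ ((1 - α) / 2) * v := by
          exact mul_le_mul (mul_le_mul_of_nonneg_right (h r hr hr0) (by positivity)) hv hρ0.le
            (by positivity)
      _ = δ * (2 ^ ((α - 1) / 2) * r ^ ((1 - α) / 2) * v) := by ring
      _ ≤ δ * (v ^ (α - 1) * v) := by gcongr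

lemma exists_isTrapping {α β δ : ℝ} (hα : 0 ≤ α) (hδ : 0 < δ) (hγ : 0 < α + 2 * β - 3) :
    ∃ k r₀, IsTrapping α β δ k r₀ := by
  obtain ⟨k₁, h1, -, h1'⟩ := exists_mul_rpow_le (m := δ * 2 ^ α) (p := α + 1) (c := 1 / 8)
    (by positivity) (by positivity) (by norm_num)
  -- The `+ 1` keeps the factor positive when `κ = 0`.
  obtain ⟨k₂, h2, -, h2'⟩ := exists_mul_rpow_le (m := |terminalExponent α β| + 1) (p := (2 : ℕ))
    (c := 1 / 8) (by positivity) (by norm_num) (by norm_num)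
  have hk : 0 < min (1 / 2) (min k₁ k₂) := lt_min (by norm_num) (lt_min h1 h2)
  obtain ⟨r₀, h3, h4, h5⟩ := exists_drag_large hα hδ hγ hk
  have m1 : min (1 / 2) (min k₁ k₂) ≤ k₁ := (min_le_right _ _).trans (min_le_left _ _)
  have m2 : min (1 / 2) (min k₁ k₂) ≤ k₂ := (min_le_right _ _).trans (min_le_right _ _)
  refine ⟨_, r₀, hk, min_le_left _ _, h1' _ hk m1, ?_, h3, h4, h5⟩
  have := h2' _ hk m2
  rw [Real.rpow_natCast] at this
  nlinarith [sq_nonneg (min (1 / 2) (min k₁ k₂))]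

lemma isOpen_trappingRegion (α β k r₀ : ℝ) : IsOpen (trappingRegion α β k r₀) := by
  rw [isOpen_iff_mem_nhds]
  rintro z ⟨h0, h1, h2, h3, h4⟩
  have hr : ContinuousAt (fun z : Plane × Plane => ‖z.1‖) z := by fun_prop
  have hr0 : ‖z.1‖ ≠ 0 := norm_ne_zero_iff.2 h0
  have hv : ContinuousAt (fun z : Plane × Plane => ‖z.2‖ ^ 2 / 2 - ‖z.1‖⁻¹) z :=
    ContinuousAt.sub (by fun_prop) (hr.inv₀ hr0)
  have hL : ContinuousAt (fun z : Plane × Plane => angularMomentum z.1 z.2 ^ 2 *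
      ‖z.1‖ ^ (-(2 * decayExponent α β))) z := by
    refine ContinuousAt.mul ?_ (hr.rpow_const (Or.inl hr0))
    unfold angularMomentum
    fun_prop
  have hg : ContinuousAt (fun z : Plane × Plane => -(inner ℝ z.1 z.2 / ‖z.1‖) -
      k * ‖z.1‖ ^ terminalExponent α β) z :=
    ((ContinuousAt.inner continuousAt_fst continuousAt_snd).div hr hr0).neg.sub
      ((hr.rpow_const (Or.inl hr0)).const_mul k)
  filter_upwards [isOpen_phaseSpace.mem_nhds h0, hr.eventually (gt_mem_nhds h1),
    hv.eventually (gt_mem_nhds h2), hL.eventually (gt_mem_nhds h3),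
    hg.eventually (lt_mem_nhds h4)] with y y0 y1 y2 y3 y4
  exact ⟨y0, y1, y2, y3, y4⟩

lemma IsTrapping.nonempty {α β δ k r₀ : ℝ} (hT : IsTrapping α β δ k r₀) (hα : 0 ≤ α)
    (hγ : 0 < α + 2 * β - 3) : (trappingRegion α β k r₀).Nonempty := by
  have hk := hT.k_pos
  have hr0 := hT.r_pos
  set κ := terminalExponent α β with hκ
  have hκ1 : 0 < 2 * κ + 1 := two_mul_terminalExponent_add_one_pos hα hγ
  set r := r₀ / 2 with hr
  have hrp : 0 < r := by positivity
  have hr1 : r ≤ 1 := by linarith [hT.r_le]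
  have hn : ‖(!₂[r, 0] : Plane)‖ = r := by
    rw [← sq_eq_sq₀ (norm_nonneg _) hrp.le, plane_norm_sq]; simp
  -- Radial infall at twice the critical speed; `2 κ + 1 > 0` makes its energy negative.
  refine ⟨(!₂[r, 0], !₂[-(2 * k * r ^ κ), 0]), ?_, ?_, ?_, ?_, ?_⟩
  · exact norm_pos_iff.1 (by rw [hn]; exact hrp)
  · rw [hn]; linarith
  · rw [hn, plane_norm_sq]
    have e : r ^ κ * r ^ κ * r = r ^ (2 * κ + 1) := by
      rw [Real.rpow_add_one hrp.ne', two_mul, Real.rpow_add hrp]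
    have h1 : r ^ (2 * κ + 1) ≤ 1 := Real.rpow_le_one hrp.le hr1 hκ1.le
    have h2 : 2 * k ^ 2 * (r ^ κ * r ^ κ) * r < 1 := by
      rw [mul_assoc, e]
      have : k ^ 2 ≤ (1 / 2) ^ 2 := by gcongr; exact hT.k_le
      have h3 : 0 < r ^ (2 * κ + 1) := by positivity
      nlinarith
    have h4 : 2 * k ^ 2 * (r ^ κ * r ^ κ) < r⁻¹ := by rwa [inv_eq_one_div, lt_div_iff₀ hrp]
    simp
    nlinarith
  · simp [angularMomentum]; positivity
  · rw [hn, plane_inner_eq]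
    simp
    have : 0 < k * r ^ κ := by positivity
    have e : r * (2 * k * r ^ κ) / r = 2 * (k * r ^ κ) := by field_simp
    rw [neg_div, neg_neg, e]
    linarith

/-- On the part of the boundary with critical radial speed the flow points inwards. -/
lemma IsTrapping.boundary_deriv_pos {α β δ k r₀ : ℝ} (hT : IsTrapping α β δ k r₀) (hα : 0 ≤ α)
    (hδ : 0 < δ) (hγ : 0 < α + 2 * β - 3) {r v ρ L : ℝ} (hr : 0 < r) (hr1 : r ≤ r₀)
    (hρ : ρ = k * r ^ terminalExponent α β) (hv0 : 0 ≤ v) (hv : r ^ 2 * v ^ 2 = r ^ 2 * ρ ^ 2 + L ^ 2)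
    (hL : L ^ 2 ≤ k ^ 2 * r ^ (2 * decayExponent α β)) :
    0 < (r ^ 2)⁻¹ - L ^ 2 / r ^ 3 - δ * v ^ α / r ^ β * ρ +
      k * (ρ * terminalExponent α β * r ^ (terminalExponent α β - 1)) := by
  have hk := hT.k_pos
  have hr1 : r ≤ 1 := hr1.trans hT.r_le
  have hκ1 := two_mul_terminalExponent_add_one_pos hα hγ
  have hm : decayExponent α β = |terminalExponent α β| + 2 := rfl
  have hκα : terminalExponent α β * (α + 1) = β - 2 := by
    rw [terminalExponent, div_mul_cancel₀ _ (by linarith)]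
  have hκle := le_abs_self (terminalExponent α β)
  have hκ2 := hT.exponent_small
  have hk4 : k ^ 2 ≤ (1 / 2) ^ 2 := by gcongr; exact hT.k_le
  set κ := terminalExponent α β with hκ
  set m := decayExponent α β with hmd
  have hρ0 : 0 < ρ := by rw [hρ]; positivity
  have hρsq : ρ ^ 2 = k ^ 2 * r ^ (2 * κ) := by
    rw [hρ, mul_pow, ← Real.rpow_natCast (r ^ κ), ← Real.rpow_mul hr.le]
    congr 2
    push_cast; ring
  -- The tangential speed is at most the radial one, so the full speed is comparable to `ρ`.
  have h1 : L ^ 2 ≤ r ^ 2 * ρ ^ 2 := by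
    have e : r ^ 2 * r ^ (2 * κ) = r ^ (2 * κ + 2) := by
      rw [Real.rpow_add hr, mul_comm]; norm_num
    have : r ^ (2 * m) ≤ r ^ (2 * κ + 2) :=
      Real.rpow_le_rpow_of_exponent_ge hr hr1 (by rw [hm]; linarith)
    calc L ^ 2 ≤ k ^ 2 * r ^ (2 * m) := hL
      _ ≤ k ^ 2 * r ^ (2 * κ + 2) := by gcongr
      _ = r ^ 2 * ρ ^ 2 := by rw [hρsq, ← e]; ring
  have hv2 : v ≤ 2 * ρ := by
    have h2 : r ^ 2 * v ^ 2 ≤ r ^ 2 * (2 * ρ ^ 2) := by linarith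
    have h3 : v ^ 2 ≤ 2 * ρ ^ 2 := le_of_mul_le_mul_left h2 (by positivity)
    exact le_of_sq_le_sq (by nlinarith [sq_nonneg ρ]) (by positivity)
  have hDρ : δ * v ^ α / r ^ β * ρ ≤ 1 / 8 * (r ^ 2)⁻¹ := by
    have e : r ^ (κ * (α + 1)) = r ^ β * (r ^ 2)⁻¹ := by
      rw [hκα, Real.rpow_sub hr, Real.rpow_two, div_eq_mul_inv]
    have e2 : (2 * ρ) ^ α * ρ = 2 ^ α * k ^ (α + 1) * (r ^ β * (r ^ 2)⁻¹) := by
      rw [Real.mul_rpow (by norm_num) hρ0.le, mul_assoc, ← Real.rpow_add_one hρ0.ne', hρ,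
        Real.mul_rpow hk.le (by positivity), ← Real.rpow_mul hr.le, e]
      ring
    calc δ * v ^ α / r ^ β * ρ ≤ δ * (2 * ρ) ^ α / r ^ β * ρ := by gcongr
      _ = δ * ((2 * ρ) ^ α * ρ) / r ^ β := by ring
      _ = δ * 2 ^ α * k ^ (α + 1) * (r ^ 2)⁻¹ := by rw [e2]; field_simp
      _ ≤ 1 / 8 * (r ^ 2)⁻¹ := by gcongr; exact hT.drag_small
  have hL3 : L ^ 2 / r ^ 3 ≤ 1 / 4 * (r ^ 2)⁻¹ := by
    have h2 : r ^ (2 * m) ≤ r := by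
      calc r ^ (2 * m) ≤ r ^ (1 : ℝ) := Real.rpow_le_rpow_of_exponent_ge hr hr1
            (by rw [hm]; linarith [abs_nonneg κ])
        _ = r := Real.rpow_one r
    calc L ^ 2 / r ^ 3 ≤ (1 / 2) ^ 2 * r / r ^ 3 := by
          gcongr
          exact hL.trans (by gcongr)
      _ = 1 / 4 * (r ^ 2)⁻¹ := by field_simp; norm_num
  have hlast : -(1 / 8 * (r ^ 2)⁻¹) ≤ k * (ρ * κ * r ^ (κ - 1)) := by
    have e : k * (ρ * κ * r ^ (κ - 1)) = κ * k ^ 2 * r ^ (2 * κ + 1) * (r ^ 2)⁻¹ := by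
      have e1 : r ^ (2 * κ + 1) = r ^ κ * r ^ (κ - 1) * r ^ 2 := by
        rw [← Real.rpow_natCast r 2, ← Real.rpow_add hr, ← Real.rpow_add hr]
        congr 1
        push_cast; ring
      rw [e1, hρ]
      field_simp
    have h2 : r ^ (2 * κ + 1) ≤ 1 := Real.rpow_le_one hr.le hr1 hκ1.le
    have h3 : |κ * k ^ 2 * r ^ (2 * κ + 1)| ≤ 1 / 8 := by
      rw [abs_mul, abs_mul, abs_of_nonneg (sq_nonneg k),
        abs_of_nonneg (Real.rpow_nonneg hr.le (2 * κ + 1))]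
      calc |κ| * k ^ 2 * r ^ (2 * κ + 1) ≤ |κ| * k ^ 2 * 1 := by gcongr
        _ ≤ 1 / 8 := by linarith
    rw [e]
    have h4 : 0 < (r ^ 2)⁻¹ := by positivity
    nlinarith [(abs_le.1 h3).1]
  -- Drag, centrifugal term and moving threshold cost at most `1/8 + 1/4 + 1/8` of gravity.
  have hx : 0 < (r ^ 2)⁻¹ := by positivity
  linarith

/-- Needs the sign only up to `T`, as in the invariance argument, where nothing is known about later
times. -/
lemma le_of_deriv_nonpos_Icc {g g' : ℝ → ℝ} {T : ℝ} (hT : 0 ≤ T)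
    (hg : ∀ t ∈ Icc 0 T, HasDerivWithinAt g (g' t) (Ici 0) t) (h : ∀ t ∈ Icc 0 T, g' t ≤ 0) :
    g T ≤ g 0 := by
  refine antitoneOn_of_hasDerivWithinAt_nonpos (convex_Icc 0 T)
    (fun t ht => (hg t ht).continuousWithinAt.mono Icc_subset_Ici_self)
    (fun t ht => (hg t (interior_subset ht)).mono
      (interior_subset.trans Icc_subset_Ici_self))
    (fun t ht => h t (interior_subset ht)) ⟨le_rfl, hT⟩ ⟨hT, le_rfl⟩ hT

lemma neg_radial_velocity_le_norm {u : Plane} (hu : u ≠ 0) (v : Plane) :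
    -(inner ℝ u v / ‖u‖) ≤ ‖v‖ := by
  rw [← neg_div, div_le_iff₀ (norm_pos_iff.2 hu), mul_comm]
  exact (neg_le_abs _).trans (abs_real_inner_le_norm u v)

/-! ### Dynamics in the trapping region -/

section Trapped

variable {α β δ k r₀ : ℝ} {ω : EReal} {u w : ℝ → Plane}

lemma IsSolution.norm_sq_velocity_le (h : IsSolution (friction α β δ) ω u w) (hδ : 0 < δ)
    (hz : (u 0, w 0) ∈ trappingRegion α β k r₀) {t : ℝ} (ht : t ∈ timeInterval ω) :
    ‖w t‖ ^ 2 ≤ 2 / ‖u t‖ := by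
  have := le_of_deriv_nonpos (t₀ := 0) (fun t ht _ => h.hasDeriv_energy ht)
    (fun t _ _ => by
      have := drag_nonneg (α := α) (β := β) hδ (u t) (w t)
      rw [neg_nonpos]; positivity) 0 (zero_mem_timeInterval h.pos) t ht le_rfl ht.1
  have h0 : ‖w 0‖ ^ 2 / 2 - ‖u 0‖⁻¹ < 0 := hz.2.2.1
  rw [div_eq_mul_inv]
  linarith

/-- Bounds at a time up to which the inward radial speed has not dropped below the critical one. -/
lemma IsSolution.trapped_bounds (h : IsSolution (friction α β δ) ω u w)
    (hT : IsTrapping α β δ k r₀) (hδ : 0 < δ) (hz : (u 0, w 0) ∈ trappingRegion α β k r₀)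
    {t : ℝ} (ht : t ∈ timeInterval ω)
    (hg : ∀ s ∈ Icc 0 t,
      0 ≤ -(inner ℝ (u s) (w s) / ‖u s‖) - k * ‖u s‖ ^ terminalExponent α β) :
    ‖u t‖ ≤ r₀ ∧
      angularMomentum (u t) (w t) ^ 2 ≤ k ^ 2 * ‖u t‖ ^ (2 * decayExponent α β) := by
  have hk := hT.k_pos
  have hm : ∀ s ∈ Icc 0 t, s ∈ timeInterval ω := fun s hs => timeInterval_mono ht hs.1 hs.2
  have hr : ∀ s ∈ Icc 0 t, ‖u s‖ ≤ r₀ := by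
    intro s hs
    have := le_of_deriv_nonpos_Icc hs.1
      (fun x hx => h.hasDeriv_norm (hm x ⟨hx.1, hx.2.trans hs.2⟩)) (fun x hx => by
        have h1 := hg x ⟨hx.1, hx.2.trans hs.2⟩
        have h2 : 0 ≤ k * ‖u x‖ ^ terminalExponent α β := by positivity
        linarith)
    exact this.trans hz.2.1.le
  have htt : t ∈ Icc 0 t := ⟨ht.1, le_rfl⟩
  refine ⟨hr t htt, ?_⟩
  -- `L² r ^ (-2m)` is nonincreasing: its logarithmic derivative is `2 (m ρ / r - D)`, which
  -- `drag_large` makes nonpositive.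
  have hq := le_of_deriv_nonpos_Icc ht.1
    (fun x hx => (h.hasDeriv_angularMomentum_sq (hm x hx)).mul
      ((h.hasDeriv_norm (hm x hx)).rpow_const (p := -(2 * decayExponent α β))
        (Or.inl (h.norm_pos (hm x hx)).ne'))) (fun x hx => by
      have hrx := h.norm_pos (hm x hx)
      have h1 := hT.drag_large ‖u x‖ ‖w x‖ (-(inner ℝ (u x) (w x) / ‖u x‖)) hrx (hr x hx)
        (by linarith [hg x hx]) (neg_radial_velocity_le_norm (h.ne_zero (hm x hx)) _)
        (h.norm_sq_velocity_le hδ hz (hm x hx))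
      have h2 : 0 ≤ angularMomentum (u x) (w x) ^ 2 * ‖u x‖ ^ (-(2 * decayExponent α β)) := by
        positivity
      have h1 : decayExponent α β * (-(inner ℝ (u x) (w x) / ‖u x‖) / ‖u x‖) ≤
        drag α β δ (u x) (w x) := h1
      rw [Real.rpow_sub_one hrx.ne']
      have e : -(2 * drag α β δ (u x) (w x) * angularMomentum (u x) (w x) ^ 2) *
          ‖u x‖ ^ (-(2 * decayExponent α β)) + angularMomentum (u x) (w x) ^ 2 *
          (inner ℝ (u x) (w x) / ‖u x‖ * -(2 * decayExponent α β) *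
          (‖u x‖ ^ (-(2 * decayExponent α β)) / ‖u x‖)) =
          2 * (angularMomentum (u x) (w x) ^ 2 * ‖u x‖ ^ (-(2 * decayExponent α β))) *
          (decayExponent α β * (-(inner ℝ (u x) (w x) / ‖u x‖) / ‖u x‖) -
            drag α β δ (u x) (w x)) := by ring
      rw [e]
      exact mul_nonpos_of_nonneg_of_nonpos (by positivity) (by linarith))
  have h3 := hq.trans hz.2.2.2.1.le
  have hrt := h.norm_pos ht
  simp only [Pi.mul_apply] at h3
  rwa [Real.rpow_neg hrt.le, ← div_eq_mul_inv, div_le_iff₀ (by positivity)] at h3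

/-- The trapping region is positively invariant. -/
lemma IsSolution.inward_speed_pos (h : IsSolution (friction α β δ) ω u w)
    (hT : IsTrapping α β δ k r₀) (hα : 0 ≤ α) (hδ : 0 < δ) (hγ : 0 < α + 2 * β - 3)
    (hz : (u 0, w 0) ∈ trappingRegion α β k r₀) :
    ∀ t ∈ timeInterval ω,
      0 < -(inner ℝ (u t) (w t) / ‖u t‖) - k * ‖u t‖ ^ terminalExponent α β := by
  refine pos_of_deriv_pos_of_eq_zero (fun t ht => (h.hasDeriv_inward_speed ht).sub
    (((h.hasDeriv_norm ht).rpow_const (p := terminalExponent α β)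
      (Or.inl (h.norm_pos ht).ne')).const_mul k)) hz.2.2.2.2 fun t ht hg h0 => ?_
  obtain ⟨b1, b2⟩ := h.trapped_bounds hT hδ hz ht hg
  have hr := h.norm_pos ht
  have := hT.boundary_deriv_pos hα hδ hγ (v := ‖w t‖)
    (ρ := -(inner ℝ (u t) (w t) / ‖u t‖)) hr b1 (sub_eq_zero.1 h0) (norm_nonneg _)
    (by rw [norm_sq_mul_norm_sq]; field_simp) b2
  refine this.trans_le (le_of_eq ?_)
  rw [drag]
  ring

/-- Along a maximal solution in the trapping region the position reaches the origin. -/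
lemma IsMaximalSolution.tendsto_norm_of_trapped {z : Plane × Plane}
    (h : IsMaximalSolution (friction α β δ) z ω u w) (hT : IsTrapping α β δ k r₀)
    (hα : 0 ≤ α) (hβ : 0 ≤ β) (hδ : 0 < δ)
    (hg : ∀ t ∈ timeInterval ω,
      0 < -(inner ℝ (u t) (w t) / ‖u t‖) - k * ‖u t‖ ^ terminalExponent α β)
    (hr : ∀ t ∈ timeInterval ω, ‖u t‖ ≤ r₀) (hv : ∀ t ∈ timeInterval ω, ‖w t‖ ^ 2 ≤ 2 / ‖u t‖) :
    Tendsto (fun t => ‖u t‖) (endFilter ω) (𝓝 0) := by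
  have hk := hT.k_pos
  have h0m := zero_mem_timeInterval h.pos
  have hanti := le_of_deriv_nonpos (ω := ω) (t₀ := 0) (fun t ht _ => h.hasDeriv_norm ht)
    (fun t ht _ => by
      have h1 := hg t ht
      have h2 : 0 ≤ k * ‖u t‖ ^ terminalExponent α β := by positivity
      linarith)
  refine Metric.tendsto_nhds.2 fun c hc => ?_
  rw [eventually_endFilter h.pos]
  suffices hex : ∃ t ∈ timeInterval ω, ‖u t‖ < c by
    obtain ⟨t₀, ht₀, h1⟩ := hex
    refine ⟨t₀, ht₀, fun t ht h2 => ?_⟩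
    rw [dist_zero_right, norm_norm]
    exact (hanti t₀ ht₀ t ht ht₀.1 h2).trans_lt h1
  by_contra! hcon
  -- The minimum covers both signs of `κ` for radii in `[c, 1]`.
  set d := k * min (c ^ terminalExponent α β) 1 with hd
  have hd0 : 0 < d := mul_pos hk (lt_min (by positivity) one_pos)
  have hspeed : ∀ t ∈ timeInterval ω, d ≤ -(inner ℝ (u t) (w t) / ‖u t‖) := by
    intro t ht
    have h1 : min (c ^ terminalExponent α β) 1 ≤ ‖u t‖ ^ terminalExponent α β := by
      rcases le_total 0 (terminalExponent α β) with hκ | hκ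
      · exact (min_le_left _ _).trans (Real.rpow_le_rpow hc.le (hcon t ht) hκ)
      · exact (min_le_right _ _).trans (Real.one_le_rpow_of_pos_of_le_one_of_nonpos
          (h.norm_pos ht) ((hr t ht).trans hT.r_le) hκ)
    have h2 : d ≤ k * ‖u t‖ ^ terminalExponent α β := by rw [hd]; gcongr
    linarith [hg t ht]
  have hbound : ∀ t ∈ timeInterval ω, d * t ≤ ‖u 0‖ := by
    intro t ht
    have := le_of_deriv_nonpos (ω := ω) (t₀ := 0) (g := fun t => ‖u t‖ + d * t)
      (fun t ht _ => (h.hasDeriv_norm ht).add ((hasDerivAt_id t).const_mul d).hasDerivWithinAt)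
      (fun t ht _ => by linarith [hspeed t ht]) 0 h0m t ht le_rfl ht.1
    have h1 := h.norm_pos ht
    have h2 : ‖u t‖ + d * t ≤ ‖u 0‖ + d * 0 := this
    linarith
  refine h.not_bounded hα hβ hδ ?_ h0m hc (C := √(2 / c)) fun t ht _ => ⟨hcon t ht, ?_⟩
  · rintro rfl
    have := hbound (‖u 0‖ / d + 1) ⟨by positivity, EReal.coe_lt_top _⟩
    have e : d * (‖u 0‖ / d + 1) = ‖u 0‖ + d := by field_simp
    linarith
  · refine Real.le_sqrt_of_sq_le ((hv t ht).trans ?_)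
    have := hcon t ht
    gcongr

/-- Along a maximal solution in the trapping region the eccentricity vector tends to a unit
vector. -/
theorem IsMaximalSolution.exists_tendsto_eccentricityVector {z : Plane × Plane}
    (h : IsMaximalSolution (friction α β δ) z ω u w) (hT : IsTrapping α β δ k r₀)
    (hα : 0 ≤ α) (hβ : 0 ≤ β) (hδ : 0 < δ) (hγ : 0 < α + 2 * β - 3)
    (hz : z ∈ trappingRegion α β k r₀) :
    ∃ Eω : Plane, ‖Eω‖ = 1 ∧
      Tendsto (fun t => eccentricityVector (u t) (w t)) (endFilter ω) (𝓝 Eω) := by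
  have hk := hT.k_pos
  have hz : (u 0, w 0) ∈ trappingRegion α β k r₀ := by
    rw [h.init_position, h.init_velocity]; exact hz
  have hg := h.toIsSolution.inward_speed_pos hT hα hδ hγ hz
  have hb := fun t ht => h.toIsSolution.trapped_bounds hT hδ hz (t := t) ht
    fun s hs => (hg s (timeInterval_mono ht hs.1 hs.2)).le
  have hv := fun t ht => h.toIsSolution.norm_sq_velocity_le hδ hz (t := t) ht
  have hlim := h.tendsto_norm_of_trapped hT hα hβ hδ hg (fun t ht => (hb t ht).1) hv
  have h0m := zero_mem_timeInterval h.pos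
  have hm : decayExponent α β = |terminalExponent α β| + 2 := rfl
  -- The radius pays for the turning: `|L| / r² ≤ k r ^ (m - 2) ≤ k r ^ κ ≤ -r'`, which is why `m =
  -- |κ| + 2`.
  obtain ⟨n, hn⟩ := exists_tendsto_endFilter h.pos (B := 0) h0m
    (norm_sub_le_of_norm_deriv_le (t₀ := 0) (fun t ht => h.hasDeriv_direction ht)
      (fun t ht _ => h.hasDeriv_norm ht) (fun t ht _ => by
        rw [h.norm_deriv_direction ht]
        have hr := h.norm_pos ht
        have hr1 : ‖u t‖ ≤ 1 := (hb t ht).1.trans hT.r_le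
        have h1 : |angularMomentum (u t) (w t)| ≤ k * ‖u t‖ ^ decayExponent α β := by
          refine abs_le_of_sq_le_sq ((hb t ht).2.trans (le_of_eq ?_)) (by positivity)
          rw [mul_pow, ← Real.rpow_natCast (_ ^ _), ← Real.rpow_mul hr.le]
          congr 2
          push_cast; ring
        have h2 : ‖u t‖ ^ decayExponent α β ≤ ‖u t‖ ^ terminalExponent α β * ‖u t‖ ^ 2 := by
          rw [← Real.rpow_natCast ‖u t‖ 2, ← Real.rpow_add hr]
          refine Real.rpow_le_rpow_of_exponent_ge hr hr1 ?_
          rw [hm]; push_cast; linarith [le_abs_self (terminalExponent α β)]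
        have h3 : |angularMomentum (u t) (w t)| / ‖u t‖ ^ 2 ≤
            k * ‖u t‖ ^ terminalExponent α β := by
          rw [div_le_iff₀ (by positivity)]
          calc _ ≤ k * ‖u t‖ ^ decayExponent α β := h1
            _ ≤ k * (‖u t‖ ^ terminalExponent α β * ‖u t‖ ^ 2) := by gcongr
            _ = _ := by ring
        linarith [hg t ht])) (fun t _ _ => norm_nonneg (u t))
  have := endFilter_neBot h.pos
  have hmem : ∀ᶠ t in endFilter ω, t ∈ timeInterval ω :=
    (eventually_endFilter h.pos).2 ⟨0, h0m, fun t ht _ => ht⟩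
  have hn1 : ‖n‖ = 1 := by
    refine tendsto_nhds_unique hn.norm (tendsto_const_nhds.congr' ?_)
    filter_upwards [hmem] with t ht
    rw [norm_direction (h.ne_zero ht)]
  -- The energy bound on `|v|²` loses one power of `r`, while `L²` supplies at least two.
  have hc : Tendsto (fun t => momentumCross (u t) (w t)) (endFilter ω) (𝓝 0) := by
    have hsqrt : Tendsto (fun t => √‖u t‖) (endFilter ω) (𝓝 0) := by
      simpa using hlim.sqrt
    refine squeeze_zero_norm' ?_ hsqrt
    filter_upwards [hmem] with t ht
    have hr := h.norm_pos ht
    have hr1 : ‖u t‖ ≤ 1 := (hb t ht).1.trans hT.r_le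
    have h2 : ‖u t‖ ^ (2 * decayExponent α β) ≤ ‖u t‖ ^ 2 := by
      rw [← Real.rpow_natCast ‖u t‖ 2]
      refine Real.rpow_le_rpow_of_exponent_ge hr hr1 ?_
      rw [hm]; push_cast; linarith [abs_nonneg (terminalExponent α β)]
    have hk2 : k ^ 2 ≤ (1 / 2) ^ 2 := by gcongr; exact hT.k_le
    rw [norm_momentumCross]
    refine Real.le_sqrt_of_sq_le ?_
    rw [mul_pow, sq_abs]
    calc ‖w t‖ ^ 2 * angularMomentum (u t) (w t) ^ 2
        ≤ 2 / ‖u t‖ * (k ^ 2 * ‖u t‖ ^ (2 * decayExponent α β)) := by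
          gcongr
          · exact hv t ht
          · exact (hb t ht).2
      _ ≤ 2 / ‖u t‖ * ((1 / 2) ^ 2 * ‖u t‖ ^ 2) := by gcongr
      _ = ‖u t‖ / 2 := by field_simp
      _ ≤ ‖u t‖ := by linarith
  refine ⟨-n, by rw [norm_neg, hn1], ?_⟩
  simpa [eccentricityVector_eq] using hc.sub hn

end Trapped

end DampedKepler

theorem mainTheorem3 (α β δ : ℝ) (hα : 0 ≤ α) (hβ : 0 ≤ β) (hδ : 0 < δ)
    (hγ : 0 < α + 2 * β - 3) :
    (∀ z ∈ DampedKepler.phaseSpace,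
      ¬ DampedKepler.CircularizesAt (DampedKepler.friction α β δ) z) ∧
    ∃ U : Set (DampedKepler.Plane × DampedKepler.Plane),
      IsOpen U ∧ U.Nonempty ∧ U ⊆ DampedKepler.phaseSpace ∧
      ∀ z ∈ U,
        (∃ (ω : EReal) (u w : ℝ → DampedKepler.Plane),
          DampedKepler.IsMaximalSolution (DampedKepler.friction α β δ) z ω u w) ∧
        ∀ (ω : EReal) (u w : ℝ → DampedKepler.Plane),
          DampedKepler.IsMaximalSolution (DampedKepler.friction α β δ) z ω u w →
          ∃ Eω : DampedKepler.Plane, ‖Eω‖ = 1 ∧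
            Tendsto (fun t => DampedKepler.eccentricityVector (u t) (w t))
              (DampedKepler.endFilter ω) (𝓝 Eω) := by
  refine ⟨fun z _ => DampedKepler.not_circularizesAt hα hβ hδ hγ z, ?_⟩
  obtain ⟨k, r₀, hT⟩ := DampedKepler.exists_isTrapping hα hδ hγ
  exact ⟨DampedKepler.trappingRegion α β k r₀, DampedKepler.isOpen_trappingRegion α β k r₀,
    hT.nonempty hα hγ, fun z hz => hz.1, fun z hz =>
      ⟨DampedKepler.exists_isMaximalSolution hα β δ hz.1, fun ω u w h =>
        h.exists_tendsto_eccentricityVector hT hα hβ hδ hγ hz⟩⟩
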